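/- Let $m,N\in\mathbb N$. For $i\in\{1,\dots,m\}$ let $H_i:\mathbb R^N\times\mathbb R^N\to\mathbb R$ be such that: $H_i$ is uniformly continuous on $\mathbb R^N\times B_R$ for every $R>0$; $p\mapsto H_i(x,p)$ is convex for every $x$; and $\alpha_i(|p|)\le H_i(x,p)\le\beta_i(|p|)$ for all $(x,p)$, for some functions $\alpha_i,\beta_i:[0,\infty)\to\mathbb R$ with $\alpha_i(h)/h\to+\infty$ and $\beta_i(h)/h\to+\infty$ as $h\to+\infty$. Let $L_i(x,q)=\sup_{p\in\mathbb R^N}\{\langle p,q\rangle-H_i(x,p)\}$. Let $B=(b_{ij})$ be a real $m\times m$ matrix with $b_{ij}\le 0$ for $j\ne i$ and $\sum_j b_{ij}=0$ for every $i$. Consider the system $$\partial_t u_i+H_i(x,D_xu_i)+(B\mathbf u(t,x))_i=0\quad\text{in }(0,+\infty)\times\mathbb R^N,\qquad i=1,\dots,m.\tag{HJS}$$ A function $\mathbf u$ that is locally bounded from above in $(0,\infty)\times\mathbb R^N$ is a viscosity subsolution of (HJS) if $p_t+H_i(x,p_x)+(B\mathbf u^*(t,x))_i\le 0$ for all $(t,x)\in(0,\infty)\times\mathbb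 R^N$, all $i$ and all $(p_t,p_x)$ in the superdifferential $D^+u_i^*(t,x)$, i.e. all $(p_t,p_x)=(\partial_t\phi(t,x),D_x\phi(t,x))$ with $\phi$ of class $C^1$ near $(t,x)$ and $u_i^*-\phi$ having a local maximum at $(t,x)$; here $\mathbf u^*$ is the componentwise upper semicontinuous envelope. Let $\Omega$ be the set of càdlàg paths $\omega:[0,\infty)\to\{1,\dots,m\}$ with the $\sigma$-algebra generated by the evaluations $\omega\mapsto\omega(t)$, and let $\mathbb P$ be a probability measure on $\Omega$ under which $(\omega(t))_{t\ge0}$ is a Markov chain with generator matrix $-B$, such that $\mathbb P(\omega(0)=i)>0$ for every $i$. Let $\mathbb E_i$ be the expectation with respect to $\mathbb P$ conditioned to $\{\omega(0)=i\}$. An admissible curve is a random variable $\gamma:\Omega\to C([0,\infty);\mathbb R^N)$ (Borel for local uniform convergence) that is locally absolutely continuous in $t$, uniformly in $\omega$ (for every bounded interval $I$ and $\varepsilon>0$ there is $\delta>0$ such that $\sum_j(b_j-a_j)<\delta$ implies $\sum_j|\gamma(b_j,\omega)-\gamma(a_j,\omega)|<\varepsilon$ for all $\omega$ and all finite families of pairwise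 disjoint intervals $(a_j,b_j)\subset I$), and nonanticipating ($\omega_1=\omega_2$ on $[0,t]$ implies $\gamma(\cdot,\omega_1)=\gamma(\cdot,\omega_2)$ on $[0,t]$). For bounded $\mathbf u^0:\mathbb R^N\to\mathbb R^m$, $t\ge0$, $x\in\mathbb R^N$ and $i\in\{1,\dots,m\}$ put $$\big(\mathcal S(t)\mathbf u^0\big)_i(x)=\inf_{\gamma}\ \mathbb E_i\Big[u^0_{\omega(t)}\big(\gamma(t,\omega)\big)+\int_0^tL_{\omega(s)}\big(\gamma(s,\omega),-\dot\gamma(s,\omega)\big)\,ds\Big],$$ the infimum being over all admissible curves $\gamma$ with $\gamma(0,\omega)=x$ for every $\omega$ (the integral and the expectation may be $+\infty$). **Proposition.** Let $\mathbf u:[0,\infty)\times\mathbb R^N\to\mathbb R^m$ be a locally Lipschitz continuous viscosity subsolution of (HJS) such that $\mathbf u^0:=\mathbf u(0,\cdot)$ is bounded. Then $$u_i(t,x)\le\big(\mathcal S(t)\mathbf u^0\big)_i(x)\qquad\text{for all }(t,x)\in[0,\infty)\times\mathbb R^N,\ i\in\{1,\dots,m\}.$$ -/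

import Mathlib

open Set Filter Topology MeasureTheory
open scoped NNReal ENNReal

namespace RandomLaxOleinik

/-- The Euclidean space `ℝ^N`. -/
abbrev E (N : ℕ) : Type := EuclideanSpace ℝ (Fin N)

/-! ### The weakly coupled system -/

/-- A function on `[0, ∞)` is superlinear when `α h / h → +∞` as `h → +∞`. -/
def Superlinear (α : ℝ≥0 → ℝ) : Prop :=
  Tendsto (fun h : ℝ≥0 => α h / (h : ℝ)) atTop atTop

/-- The standing assumptions on a Hamiltonian `H(x, p)`. -/
structure IsHamiltonian {N : ℕ} (H : E N → E N → ℝ) : Prop where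
  /-- Uniform continuity on `ℝ^N × B_R` for every `R > 0`. -/
  uc : ∀ R : ℝ, 0 < R →
    UniformContinuousOn (fun z : E N × E N => H z.1 z.2) (univ ×ˢ Metric.ball 0 R)
  /-- Convexity in the momentum. -/
  convex : ∀ x, ConvexOn ℝ univ (H x)
  /-- Superlinear bounds, uniform in `x`. -/
  growth : ∃ α β : ℝ≥0 → ℝ, Superlinear α ∧ Superlinear β ∧
    ∀ x p, α ‖p‖₊ ≤ H x p ∧ H x p ≤ β ‖p‖₊

/-- The Lagrangian: the Fenchel transform of the Hamiltonian in the momentum. For a Hamiltonian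
as in `IsHamiltonian` the supremum is finite. -/
noncomputable def lagrangian {N : ℕ} (H : E N → E N → ℝ) (x q : E N) : ℝ :=
  ⨆ p : E N, (inner ℝ p q - H x p)

/-- The assumptions on the coupling matrix: nonpositive off-diagonal entries, null row sums. -/
structure IsCoupling {m : ℕ} (B : Matrix (Fin m) (Fin m) ℝ) : Prop where
  offDiag : ∀ i j, j ≠ i → B i j ≤ 0
  rowSum : ∀ i, ∑ j, B i j = 0

/-- The superdifferential `D⁺ v (z)` at `z = (t, x)`: the pairs `(∂ₜφ(z), Dₓφ(z))`, where `φ` is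
of class `C¹` in a neighbourhood of `z` and `v - φ` has a local maximum at `z`. -/
def superdifferential {N : ℕ} (v : ℝ × E N → ℝ) (z : ℝ × E N) : Set (ℝ × E N) :=
  {r | ∃ φ : ℝ × E N → ℝ, ContDiffAt ℝ 1 φ z ∧ IsLocalMax (fun y => v y - φ y) z ∧
    r.1 = deriv (fun t => φ (t, z.2)) z.1 ∧ r.2 = gradient (fun x => φ (z.1, x)) z.2}

/-- The (componentwise) upper semicontinuous envelope. It is used at points `z = (t, x)` with
`t > 0` and for functions that are bounded from above near `z`. -/
noncomputable def uscEnvelope {N m : ℕ} (u : ℝ × E N → Fin m → ℝ) (z : ℝ × E N) (i : Fin m) : ℝ :=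
  limsup (fun y => u y i) (𝓝 z)

/-- Viscosity subsolutions in `(0, ∞) × ℝ^N` of the weakly coupled system
`∂ₜ uᵢ + Hᵢ(x, Dₓ uᵢ) + (B u)ᵢ = 0`, `i = 1, …, m`.
Only the values of `u` at positive times matter. -/
structure IsSubsolution {N m : ℕ} (H : Fin m → E N → E N → ℝ) (B : Matrix (Fin m) (Fin m) ℝ)
    (u : ℝ × E N → Fin m → ℝ) : Prop where
  /-- `u` is locally bounded from above in `(0, ∞) × ℝ^N`. -/
  locBddAbove : ∀ z : ℝ × E N, 0 < z.1 → ∃ C : ℝ, ∀ᶠ y in 𝓝 z, ∀ i, u y i ≤ C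
  /-- The viscosity inequality for the upper semicontinuous envelope. -/
  visc : ∀ z : ℝ × E N, 0 < z.1 → ∀ i,
    ∀ r ∈ superdifferential (fun y => uscEnvelope u y i) z,
      r.1 + H i z.2 r.2 + B.mulVec (uscEnvelope u z) i ≤ 0

/-! ### The random frame -/

/-- The sample space `Ω`: càdlàg paths `ω : [0, ∞) → {1, …, m}`. -/
def PathSpace (m : ℕ) : Type :=
  {ω : ℝ≥0 → Fin m //
    ∀ t, ContinuousWithinAt ω (Ici t) t ∧ ∃ l, Tendsto ω (𝓝[<] t) (𝓝 l)}

instance (m : ℕ) : CoeFun (PathSpace m) (fun _ => ℝ≥0 → Fin m) := ⟨Subtype.val⟩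

/-- The σ-algebra on `Ω`: the smallest one that makes all evaluations `ω ↦ ω t` measurable (it
is the Borel σ-algebra of the Skorokhod topology). -/
instance (m : ℕ) : MeasurableSpace (PathSpace m) :=
  ⨆ t : ℝ≥0, MeasurableSpace.comap (fun ω : PathSpace m => ω t) ⊤

/-- The evaluation process is, under `P`, a Markov chain with generator matrix `-B`: for all times
`0 ≤ t₀ < ⋯ < t_{k+1}` and states `i₀, …, i_{k+1}`,
`P(ω(t_{k+1}) = i_{k+1} | ω(t₀) = i₀, …, ω(t_k) = i_k) = (exp(-(t_{k+1} - t_k) B))_{i_k i_{k+1}}`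
whenever the conditioning event is not negligible. -/
def IsMarkovChain {m : ℕ} (B : Matrix (Fin m) (Fin m) ℝ) (P : Measure (PathSpace m)) : Prop :=
  ∀ (k : ℕ) (t : Fin (k + 2) → ℝ≥0) (i : Fin (k + 2) → Fin m), StrictMono t →
    P {ω | ∀ j : Fin (k + 1), ω (t j.castSucc) = i j.castSucc} ≠ 0 →
    ProbabilityTheory.cond P {ω | ∀ j : Fin (k + 1), ω (t j.castSucc) = i j.castSucc}
        {ω | ω (t (Fin.last (k + 1))) = i (Fin.last (k + 1))} =
      ENNReal.ofReal
        (NormedSpace.exp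
          (-(((t (Fin.last (k + 1)) : ℝ) - (t (Fin.last k).castSucc : ℝ)) • B))
          (i (Fin.last k).castSucc) (i (Fin.last (k + 1))))

/-- The event `Ωᵢ` of the paths that start at `i`. -/
def startsAt {m : ℕ} (i : Fin m) : Set (PathSpace m) := {ω | ω 0 = i}

/-- The probability `Pᵢ`: `P` conditioned to `Ωᵢ`. -/
noncomputable def condStart {m : ℕ} (P : Measure (PathSpace m)) (i : Fin m) :
    Measure (PathSpace m) :=
  ProbabilityTheory.cond P (startsAt i)

/-- Admissible curves: random variables `γ : Ω → C([0, ∞); ℝ^N)` (with the Borel σ-algebra of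
the topology of local uniform convergence) that are locally absolutely continuous, uniformly with
respect to `ω`, and nonanticipating. -/
structure IsAdmissible {m N : ℕ} (γ : PathSpace m → C(ℝ≥0, E N)) : Prop where
  meas : Measurable[inferInstance, borel C(ℝ≥0, E N)] γ
  unifAC : ∀ T : ℝ≥0, ∀ ε : ℝ, 0 < ε → ∃ δ : ℝ, 0 < δ ∧
    ∀ (n : ℕ) (a b : Fin n → ℝ≥0), (∀ j, a j ≤ b j ∧ b j ≤ T) →
      Pairwise (fun j k => Disjoint (Ioo (a j) (b j)) (Ioo (a k) (b k))) →
      ∑ j, ((b j : ℝ) - (a j : ℝ)) < δ →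
      ∀ ω, ∑ j, ‖γ ω (b j) - γ ω (a j)‖ < ε
  nonant : ∀ (t : ℝ≥0) (ω₁ ω₂ : PathSpace m), (∀ s ≤ t, ω₁ s = ω₂ s) →
    ∀ s ≤ t, γ ω₁ s = γ ω₂ s

/-! ### The random Lax–Oleinik formula -/

/-- The integral of an extended real valued function, as the difference of the integrals of its
positive and negative parts. It takes values in `(-∞, +∞]` as soon as the negative part has a
finite integral, which is the only case in which it is used. -/
noncomputable def extIntegral {Ω : Type*} [MeasurableSpace Ω] (μ : Measure Ω)
    (f : Ω → EReal) : EReal :=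
  ((∫⁻ a, (f a).toENNReal ∂μ : ℝ≥0∞) : EReal) - ((∫⁻ a, (-f a).toENNReal ∂μ : ℝ≥0∞) : EReal)

/-- The velocity `γ'(s)` of a curve at time `s`. -/
noncomputable def velocity {N : ℕ} (c : C(ℝ≥0, E N)) (s : ℝ) : E N :=
  deriv (fun r : ℝ => c r.toNNReal) s

/-- The random action `∫₀ᵗ L_{ω(s)}(γ(s), -γ'(s)) ds ∈ (-∞, +∞]` of a curve along a path. -/
noncomputable def action {m N : ℕ} (H : Fin m → E N → E N → ℝ) (ω : PathSpace m)
    (c : C(ℝ≥0, E N)) (t : ℝ≥0) : EReal :=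
  extIntegral (volume.restrict (Ioc (0 : ℝ) t))
    (fun s => ((lagrangian (H (ω s.toNNReal)) (c s.toNNReal) (-velocity c s) : ℝ) : EReal))

/-- The Lax–Oleinik value
`(S(t)u⁰)ᵢ(x) = inf { Eᵢ[u⁰_{ω(t)}(γ(t,ω)) + ∫₀ᵗ L_{ω(s)}(γ(s,ω), -γ'(s,ω)) ds] }`,
the infimum being taken over all admissible curves starting at `x`. -/
noncomputable def laxOleinik {m N : ℕ} (H : Fin m → E N → E N → ℝ) (P : Measure (PathSpace m))
    (t : ℝ≥0) (u₀ : E N → Fin m → ℝ) (x : E N) (i : Fin m) : EReal :=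
  ⨅ (γ : PathSpace m → C(ℝ≥0, E N)) (_ : IsAdmissible γ) (_ : ∀ ω, γ ω 0 = x),
    extIntegral (condStart P i)
      (fun ω => ((u₀ (γ ω t) (ω t) : ℝ) : EReal) + action H ω (γ ω) t)

end RandomLaxOleinik

open RandomLaxOleinik

/-! Fix an admissible curve γ and follow `u_{ω(s)}(t - s, γ(s))` from s = 0, where it equals `u_i(t,
x)` almost surely, to s = t, where it is the initial datum. If u were smooth, the chain rule, the
subsolution inequality and the Fenchel inequality would give, for a frozen index j, a growth rate of
at least `(Bu)_j - L_j(γ, -γ')`. The jumps of the index contribute `-(Bu)_j` in the mean, because -B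
is the generator. The coupling terms cancel and the expected action remains.

Since u is only Lipschitz, it may be differentiable nowhere along γ, so time is cut into steps of
length h. On each step `exists_mem_superdifferential_le` supplies one momentum p in a
superdifferential at a nearby point. As p is constant on the step, ⟨p, γ'⟩ integrates to an
increment of γ, and Fenchel's inequality with this p bounds the action from below
(`IsSubsolution.exists_step_le`, `IsAdmissible.sum_le_action`).

The index increment plus h times the coupling term, both taken at the same point, which depends only
on the past, has mean o(h) (`IsMarkovChain.exists_abs_integral_generator_le`). The estimate with
frozen index fails on paths that jump during the step; they have probability O(h)
(`IsMarkovChain.exists_measureReal_jump_le`), and there a crude error of order ε suffices. Each step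
thus costs O(hη), the t/h steps together O(η), and η is arbitrary. -/

namespace RandomLaxOleinik

/-! ### Mean value inequality for superdifferentials -/

set_option maxHeartbeats 1000000 in
/-- A mean value inequality: the increment of a Lipschitz function along a segment is bounded, up
to an arbitrarily small error, by the increment given by an element of its superdifferential at a
nearby point. -/
theorem exists_mem_superdifferential_le {N : ℕ} {v : ℝ × E N → ℝ} {K : ℝ≥0} {a b ρ R η : ℝ}
    {x y c : E N} (hab : a < b) (hx : x ∈ Metric.closedBall c ρ) (hy : y ∈ Metric.closedBall c ρ)
    (hρ : ρ < R) (hv : LipschitzOnWith K v (Icc a b ×ˢ Metric.closedBall c R)) (hη : 0 < η) :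
    ∃ z ∈ Ioo a b ×ˢ Metric.ball c R, ∃ r ∈ superdifferential v z, ‖r.2‖ ≤ 2 * K ∧
      v (b, y) - v (a, x) ≤ (b - a) * r.1 + inner ℝ r.2 (y - x) + η := by
  have hh : 0 < b - a := sub_pos.2 hab
  set q : E N := (b - a)⁻¹ • (y - x) with hq
  set ℓ : ℝ → E N := fun s => x + (s - a) • q with hℓ
  have hqy : (b - a) • q = y - x := by rw [hq, smul_smul, mul_inv_cancel₀ hh.ne', one_smul]
  have hℓa : ℓ a = x := by simp [hℓ]
  have hℓb : ℓ b = y := by simp [hℓ, hqy]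
  have hℓmem : ∀ s ∈ Icc a b, ℓ s ∈ Metric.closedBall c ρ := by
    intro s hs
    have h1 : ℓ s = x + ((s - a) / (b - a)) • (y - x) := by
      simp only [hℓ, hq, smul_smul, div_eq_mul_inv]
    rw [h1]
    exact (convex_closedBall c ρ).add_smul_sub_mem hx hy
      ⟨div_nonneg (sub_nonneg.2 hs.1) hh.le, (div_le_one hh).2 (by linarith [hs.2])⟩
  have hball : Metric.closedBall c ρ ⊆ Metric.closedBall c R := Metric.closedBall_subset_closedBall hρ.le
  -- The mean slope of v along the segment, lowered by η in total: `v - C(s - a)` then gains η from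
  -- a to b, so a maximum cannot sit at the initial time.
  set C : ℝ := (v (b, y) - v (a, x) - η) / (b - a) with hC
  have hCh : C * (b - a) = v (b, y) - v (a, x) - η := div_mul_cancel₀ _ hh.ne'
  set M : ℝ := K * (1 + ‖q‖) + |C| with hM
  have hM0 : 0 ≤ M := by positivity
  obtain ⟨d, hd0, hdh, hdM⟩ : ∃ d, 0 < d ∧ d < b - a ∧ M * d ≤ η / 8 := by
    refine ⟨min ((b - a) / 2) (η / 8 / (M + 1)), by positivity, ?_, ?_⟩
    · exact (min_le_left _ _).trans_lt (by linarith)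
    · calc M * min ((b - a) / 2) (η / 8 / (M + 1)) ≤ (M + 1) * (η / 8 / (M + 1)) := by
            gcongr
            · linarith
            · exact min_le_right _ _
        _ = η / 8 := by field_simp
  -- At the maximum the distance to the segment is at most K / A. The two conditions make the
  -- resulting error at most η / 8 and keep the point inside the open ball.
  obtain ⟨A, hA0, hA1, hA2⟩ : ∃ A : ℝ, 0 < A ∧ (K : ℝ) ^ 2 ≤ A * (η / 8) ∧ (K : ℝ) < A * (R - ρ) := by
    have hR : 0 < R - ρ := sub_pos.2 hρ
    refine ⟨(K : ℝ) ^ 2 / (η / 8) + ((K : ℝ) + 1) / (R - ρ), by positivity, ?_, ?_⟩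
    · rw [add_mul, div_mul_cancel₀ _ (by positivity)]
      have : 0 ≤ ((K : ℝ) + 1) / (R - ρ) * (η / 8) := by positivity
      linarith
    · rw [add_mul, div_mul_cancel₀ _ hR.ne']
      have : 0 ≤ (K : ℝ) ^ 2 / (η / 8) * (R - ρ) := by positivity
      linarith
  set n : ℝ := 3 / d with hn
  have hn0 : 0 < n := by positivity
  have hexp : Real.exp (n * ((b - d) - b)) ≤ 1 / 4 := by
    have h1 : n * ((b - d) - b) = -3 := by rw [hn]; field_simp; ring
    rw [h1, Real.exp_neg, ← one_div]
    exact one_div_le_one_div_of_le (by norm_num) (by linarith [Real.add_one_le_exp (3 : ℝ)])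
  -- The exponential is a barrier that pushes the maximum away from s = b; it is increasing in time,
  -- so its derivative has the favourable sign in the final inequality.
  set φ : ℝ × E N → ℝ := fun z =>
    C * (z.1 - a) + η / 2 * Real.exp (n * (z.1 - b)) + A * ‖z.2 - ℓ z.1‖ ^ 2 with hφ
  have hφs : ContDiff ℝ 1 φ := by
    simp only [hφ, hℓ]
    refine ContDiff.add (by fun_prop) (contDiff_const.mul (ContDiff.norm_sq ℝ (by fun_prop)))
  have hQc : IsCompact (Icc a b ×ˢ Metric.closedBall c R) :=
    isCompact_Icc.prod (isCompact_closedBall c R)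
  have hbQ : (b, y) ∈ Icc a b ×ˢ Metric.closedBall c R := ⟨⟨hab.le, le_rfl⟩, hball hy⟩
  obtain ⟨z, hz, hmax⟩ := hQc.exists_isMaxOn ⟨_, hbQ⟩
    (hv.continuousOn.sub hφs.continuous.continuousOn)
  obtain ⟨s, w⟩ := z
  obtain ⟨hs, hw⟩ := hz
  simp only at hs hw
  have hle : ∀ s' ∈ Icc a b, v (s', ℓ s') - φ (s', ℓ s') ≤ v (s, w) - φ (s, w) := fun s' hs' =>
    hmax (a := (s', ℓ s')) ⟨hs', hball (hℓmem s' hs')⟩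
  have hlip : v (s, w) - v (s, ℓ s) ≤ K * ‖w - ℓ s‖ := by
    have h1 := hv.dist_le_mul (s, w) ⟨hs, hw⟩ (s, ℓ s) ⟨hs, hball (hℓmem s hs)⟩
    rw [dist_prod_same_left, dist_eq_norm w, Real.dist_eq] at h1
    exact (le_abs_self _).trans h1
  have hφℓ : ∀ s', φ (s', ℓ s') = C * (s' - a) + η / 2 * Real.exp (n * (s' - b)) := by
    intro s'; simp [hφ]
  have hAd : A * ‖w - ℓ s‖ ≤ K := by
    have h1 := hle s hs
    rw [hφℓ] at h1
    simp only [hφ] at h1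
    rcases (norm_nonneg (w - ℓ s)).eq_or_lt with h0 | h0
    · rw [← h0]; simp
    · have h2 : (A * ‖w - ℓ s‖) * ‖w - ℓ s‖ ≤ K * ‖w - ℓ s‖ := by nlinarith
      exact le_of_mul_le_mul_right h2 h0
  have hKd : K * ‖w - ℓ s‖ ≤ η / 8 := by
    have h1 : A * (K * ‖w - ℓ s‖) ≤ A * (η / 8) := by
      calc A * (K * ‖w - ℓ s‖) = K * (A * ‖w - ℓ s‖) := by ring
        _ ≤ K * K := by gcongr
        _ ≤ A * (η / 8) := by rw [← sq]; exact hA1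
    exact le_of_mul_le_mul_left h1 hA0
  have hwR : w ∈ Metric.ball c R := by
    have h1 : ‖w - ℓ s‖ < R - ρ := by
      by_contra! h2
      have := mul_le_mul_of_nonneg_left h2 hA0.le
      linarith
    rw [Metric.mem_ball]
    calc dist w c ≤ dist w (ℓ s) + dist (ℓ s) c := dist_triangle _ _ _
      _ < (R - ρ) + ρ := add_lt_add_of_lt_of_le (by rwa [dist_eq_norm]) (hℓmem s hs)
      _ = R := by ring
  have hbd : b - d ∈ Icc a b := ⟨by linarith, by linarith⟩
  have hwd : v (b, y) - v (b - d, ℓ (b - d)) ≤ K * (1 + ‖q‖) * d := by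
    have h1 := hv.dist_le_mul (b, y) hbQ (b - d, ℓ (b - d)) ⟨hbd, hball (hℓmem _ hbd)⟩
    have h2 : dist y (ℓ (b - d)) = d * ‖q‖ := by
      rw [← hℓb, dist_eq_norm]
      simp only [hℓ]
      rw [add_sub_add_left_eq_sub, ← sub_smul, norm_smul]
      rw [show b - a - (b - d - a) = d by ring, Real.norm_of_nonneg hd0.le]
    have h3 : dist b (b - d) = d := by rw [Real.dist_eq, sub_sub_cancel, abs_of_pos hd0]
    rw [Prod.dist_eq, h2, h3, Real.dist_eq] at h1
    have h4 : max d (d * ‖q‖) ≤ (1 + ‖q‖) * d :=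
      max_le (by nlinarith [norm_nonneg q]) (by nlinarith [norm_nonneg q])
    calc _ ≤ _ := (le_abs_self _).trans h1
      _ ≤ K * ((1 + ‖q‖) * d) := by gcongr
      _ = _ := by ring
  have hkey := hle (b - d) hbd
  rw [hφℓ] at hkey
  have hCd : -(C * d) ≤ |C| * d := by nlinarith [neg_abs_le C]
  -- Comparison with the point of the segment at time b - d gives at least `v (a, x) + 3η/4`. The
  -- upper bound `hup` allows only η/8 above `v (a, x)` at s = a and 5η/8 at s = b, so both ends are
  -- excluded.
  have hlow : v (a, x) + η - η / 8 - η / 8 ≤ v (s, w) - φ (s, w) := by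
    have h1 : C * (b - d - a) = C * (b - a) - C * d := by ring
    have h2 : η / 2 * Real.exp (n * (b - d - b)) ≤ η / 2 * (1 / 4) := by gcongr
    have h3 : M * d = K * (1 + ‖q‖) * d + |C| * d := by rw [hM]; ring
    have h4 : C * d ≤ |C| * d := by nlinarith [le_abs_self C]
    have h5 : -(|C| * d) ≤ C * d := by linarith
    linarith
  have hup : v (s, w) - φ (s, w) ≤
      v (s, ℓ s) + η / 8 - C * (s - a) - η / 2 * Real.exp (n * (s - b)) := by
    simp only [hφ]
    have : 0 ≤ A * ‖w - ℓ s‖ ^ 2 := by positivity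
    linarith
  have hsa : a < s := by
    rcases hs.1.eq_or_lt with h0 | h0
    · exfalso
      rw [← h0, hℓa] at hup
      have : 0 ≤ η / 2 * Real.exp (n * (a - b)) := by positivity
      rw [← h0] at hlow
      linarith
    · exact h0
  have hsb : s < b := by
    rcases hs.2.eq_or_lt with h0 | h0
    · exfalso
      rw [h0, hℓb] at hup
      simp only [sub_self, mul_zero, Real.exp_zero] at hup
      rw [h0] at hlow
      linarith
    · exact h0
  have hD : HasDerivAt (fun t => φ (t, w))
      (C + η / 2 * (Real.exp (n * (s - b)) * n) + A * (2 * inner ℝ (w - ℓ s) (-q))) s := by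
    have h1 : HasDerivAt (fun t => w - ℓ t) (-q) s := by
      have : HasDerivAt ℓ ((1 : ℝ) • q) s :=
        (((hasDerivAt_id s).sub_const a).smul_const q).const_add x
      simpa using this.const_sub w
    have h2 : HasDerivAt (fun t => C * (t - a)) C s := by
      simpa using ((hasDerivAt_id s).sub_const a).const_mul C
    have h3 : HasDerivAt (fun t => Real.exp (n * (t - b))) (Real.exp (n * (s - b)) * n) s := by
      have := (((hasDerivAt_id s).sub_const b).const_mul n).exp
      simpa using this
    exact (h2.add (h3.const_mul _)).add (h1.norm_sq.const_mul A)
  have hG : HasGradientAt (fun y => φ (s, y)) ((2 * A) • (w - ℓ s)) w := by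
    rw [hasGradientAt_iff_hasFDerivAt]
    have h1 : HasFDerivAt (fun y : E N => y - ℓ s) (ContinuousLinearMap.id ℝ (E N)) w :=
      (hasFDerivAt_id w).sub_const _
    have h2 := (h1.norm_sq.const_mul A).const_add
      (C * (s - a) + η / 2 * Real.exp (n * (s - b)))
    refine h2.congr_fderiv ?_
    ext u
    simp
    ring
  refine ⟨(s, w), ⟨⟨hsa, hsb⟩, hwR⟩, (_, _),
    ⟨φ, hφs.contDiffAt, ?_, hD.deriv.symm, hG.gradient.symm⟩, ?_, ?_⟩
  · exact hmax.isLocalMax (prod_mem_nhds (Icc_mem_nhds hsa hsb)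
      (Filter.mem_of_superset (Metric.isOpen_ball.mem_nhds hwR) Metric.ball_subset_closedBall))
  · simp only [norm_smul]
    rw [Real.norm_of_nonneg (by positivity)]
    linarith
  -- The penalty follows the moving point ℓ, so its time derivative cancels against its gradient in
  -- the direction y - x. Only C and the positive barrier term remain.
  · simp only [← hqy, inner_smul_left, inner_smul_right, inner_neg_right]
    have h1 : 0 ≤ (b - a) * (η / 2 * (Real.exp (n * (s - b)) * n)) := by positivity
    simp only [RCLike.conj_to_real]
    nlinarith

/-! ### Fenchel inequality and lower bounds of extended integrals -/

theorem IsHamiltonian.continuous {N : ℕ} {H : E N → E N → ℝ} (hH : IsHamiltonian H) (x : E N) :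
    Continuous (H x) := by
  rw [continuous_iff_continuousAt]
  intro p
  have h1 := (hH.uc (‖p‖ + 1) (by positivity)).continuousOn
  have h2 : ContinuousOn (H x) (Metric.ball 0 (‖p‖ + 1)) :=
    h1.comp (f := fun p => (x, p)) (by fun_prop) (fun p hp => ⟨mem_univ _, hp⟩)
  exact h2.continuousAt (Metric.isOpen_ball.mem_nhds (by simp))

/-- By superlinearity H(x, p) dominates |p||q| outside a ball, and continuity handles the ball.
Without this bound the real-valued supremum in `lagrangian` would be a default value. -/
theorem IsHamiltonian.bddAbove {N : ℕ} {H : E N → E N → ℝ} (hH : IsHamiltonian H) (x q : E N) :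
    BddAbove (range fun p : E N => inner ℝ p q - H x p) := by
  obtain ⟨α, β, hα, -, hαβ⟩ := hH.growth
  obtain ⟨R, hR⟩ := (tendsto_atTop.1 hα ‖q‖).exists_forall_of_atTop
  have hcont : Continuous fun p : E N => inner ℝ p q - H x p :=
    (continuous_id.inner continuous_const).sub (hH.continuous x)
  obtain ⟨C, hC⟩ := (isCompact_closedBall (0 : E N) (max R 1)).bddAbove_image hcont.continuousOn
  refine ⟨max C 0, ?_⟩
  rintro _ ⟨p, rfl⟩
  by_cases hp : ‖p‖ ≤ max (R : ℝ) 1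
  · exact (hC ⟨p, by simpa using hp, rfl⟩).trans (le_max_left _ _)
  · push Not at hp
    refine le_trans ?_ (le_max_right _ _)
    have h1 := hR ‖p‖₊ (by exact_mod_cast (le_max_left _ _).trans hp.le)
    have hp0 : 0 < ‖p‖ := lt_of_lt_of_le one_pos ((le_max_right _ _).trans hp.le)
    rw [coe_nnnorm, le_div_iff₀ hp0] at h1
    have h2 := real_inner_le_norm p q
    have h3 := (hαβ x p).1
    simp only
    nlinarith

/-- The Fenchel inequality. -/
theorem IsHamiltonian.inner_sub_le_lagrangian {N : ℕ} {H : E N → E N → ℝ} (hH : IsHamiltonian H)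
    (x p q : E N) : inner ℝ p q - H x p ≤ lagrangian H x q :=
  le_ciSup (hH.bddAbove x q) p

theorem IsHamiltonian.exists_apply_zero_le {N : ℕ} {H : E N → E N → ℝ} (hH : IsHamiltonian H) :
    ∃ C, ∀ x, H x 0 ≤ C := by
  obtain ⟨α, β, -, -, h⟩ := hH.growth
  exact ⟨β ‖(0 : E N)‖₊, fun x => (h x 0).2⟩

/-- Monotonicity of the lower integral requires no measurability of f. Hence only an integrable
minorant is ever needed, both for the Lagrangian in time and for the random action in ω. -/
theorem integral_le_extIntegral {Ω : Type*} [MeasurableSpace Ω] {μ : Measure Ω} {f : Ω → EReal}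
    {g : Ω → ℝ} (hg : Integrable g μ) (hgf : ∀ᵐ a ∂μ, (g a : EReal) ≤ f a) :
    ((∫ a, g a ∂μ : ℝ) : EReal) ≤ extIntegral μ f := by
  rw [integral_eq_lintegral_pos_part_sub_lintegral_neg_part hg]
  have h1 : ∫⁻ a, ENNReal.ofReal (g a) ∂μ ≠ ∞ := hg.lintegral_lt_top.ne
  have h2 : ∫⁻ a, ENNReal.ofReal (-g a) ∂μ ≠ ∞ := hg.neg.lintegral_lt_top.ne
  rw [EReal.coe_sub, EReal.coe_ennreal_toReal h1, EReal.coe_ennreal_toReal h2, extIntegral]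
  refine EReal.sub_le_sub ?_ ?_
  · refine EReal.coe_ennreal_le_coe_ennreal_iff.2 (lintegral_mono_ae ?_)
    filter_upwards [hgf] with a ha
    rw [← EReal.real_coe_toENNReal]
    exact EReal.toENNReal_le_toENNReal ha
  · refine EReal.coe_ennreal_le_coe_ennreal_iff.2 (lintegral_mono_ae ?_)
    filter_upwards [hgf] with a ha
    rw [← EReal.real_coe_toENNReal, EReal.coe_neg]
    exact EReal.toENNReal_le_toENNReal (EReal.neg_le_neg_iff.2 ha)

/-! ### Regularity of admissible curves -/

theorem IsAdmissible.absolutelyContinuousOnInterval {m N : ℕ} {γ : PathSpace m → C(ℝ≥0, E N)}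
    (hγ : IsAdmissible γ) (ω : PathSpace m) (p : E N) (T : ℝ≥0) :
    AbsolutelyContinuousOnInterval (fun s : ℝ => inner ℝ p (γ ω s.toNNReal)) 0 T := by
  rw [absolutelyContinuousOnInterval_iff]
  intro ε hε
  obtain ⟨δ, hδ, h⟩ := hγ.unifAC T (ε / (‖p‖ + 1)) (by positivity)
  refine ⟨δ, hδ, ?_⟩
  rintro ⟨n, I⟩ ⟨hI, hdisj⟩ hlt
  simp only at hI hdisj hlt ⊢
  rw [uIcc_of_le (NNReal.coe_nonneg T)] at hI
  have hI' : ∀ j : Fin n, (I j).1 ∈ Icc (0 : ℝ) T ∧ (I j).2 ∈ Icc (0 : ℝ) T := fun j =>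
    hI j (Finset.mem_range.2 j.2)
  have h1 := h n (fun j => (min (I j).1 (I j).2).toNNReal) (fun j => (max (I j).1 (I j).2).toNNReal)
    (fun j => ⟨Real.toNNReal_le_toNNReal min_le_max,
      Real.toNNReal_le_iff_le_coe.2 (max_le (hI' j).1.2 (hI' j).2.2)⟩) ?_ ?_ ω
  · have h2 : ∀ j : Fin n, dist (inner ℝ p (γ ω (I j).1.toNNReal))
        (inner ℝ p (γ ω (I j).2.toNNReal)) ≤ ‖p‖ *
        ‖γ ω (max (I j).1 (I j).2).toNNReal - γ ω (min (I j).1 (I j).2).toNNReal‖ := by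
      intro j
      rw [Real.dist_eq, ← inner_sub_right]
      refine (abs_real_inner_le_norm _ _).trans_eq ?_
      congr 1
      rcases le_total (I j).1 (I j).2 with h3 | h3
      · rw [max_eq_right h3, min_eq_left h3, norm_sub_rev]
      · rw [max_eq_left h3, min_eq_right h3]
    rw [Finset.sum_range (fun i => dist (inner ℝ p (γ ω (I i).1.toNNReal))
      (inner ℝ p (γ ω (I i).2.toNNReal)))]
    refine (Finset.sum_le_sum fun j _ => h2 j).trans_lt ?_
    rw [← Finset.mul_sum]
    rw [lt_div_iff₀ (by positivity)] at h1
    refine lt_of_le_of_lt ?_ h1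
    rw [mul_comm]
    gcongr
    linarith
  · intro j k hjk
    have h2 := hdisj (Finset.mem_coe.2 (Finset.mem_range.2 j.2))
      (Finset.mem_coe.2 (Finset.mem_range.2 k.2)) (fun h => hjk (Fin.ext h))
    rw [Set.disjoint_left]
    intro s hs1 hs2
    have key : ∀ i : Fin n, s ∈ Ioo (min (I i).1 (I i).2).toNNReal (max (I i).1 (I i).2).toNNReal →
        (s : ℝ) ∈ uIoc (I i).1 (I i).2 := by
      intro i hi
      rw [mem_Ioo, ← NNReal.coe_lt_coe, ← NNReal.coe_lt_coe,
        Real.coe_toNNReal _ (le_min (hI' i).1.1 (hI' i).2.1),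
        Real.coe_toNNReal _ (le_max_of_le_left (hI' i).1.1)] at hi
      exact ⟨hi.1, hi.2.le⟩
    exact Set.disjoint_left.1 h2 (key j hs1) (key k hs2)
  · rw [Finset.sum_range (fun i => dist (I i).1 (I i).2)] at hlt
    refine lt_of_le_of_lt (Finset.sum_le_sum fun j _ => ?_) hlt
    rw [Real.coe_toNNReal _ (le_min (hI' j).1.1 (hI' j).2.1),
        Real.coe_toNNReal _ (le_max_of_le_left (hI' j).1.1), Real.dist_eq, max_sub_min_eq_abs']

/-- The finitely many coordinates are absolutely continuous, so almost everywhere all are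
differentiable and the velocity is a true derivative rather than the default value 0. -/
theorem IsAdmissible.ae_deriv_inner {m N : ℕ} {γ : PathSpace m → C(ℝ≥0, E N)}
    (hγ : IsAdmissible γ) (ω : PathSpace m) (p : E N) (T : ℝ≥0) :
    ∀ᵐ s : ℝ, s ∈ uIcc (0 : ℝ) T →
      deriv (fun s : ℝ => inner ℝ p (γ ω s.toNNReal)) s = inner ℝ p (velocity (γ ω) s) := by
  have h : ∀ᵐ s : ℝ, ∀ i : Fin N, s ∈ uIcc (0 : ℝ) T →
      DifferentiableAt ℝ
        (fun s : ℝ => inner ℝ (EuclideanSpace.single i (1 : ℝ)) (γ ω s.toNNReal)) s :=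
    ae_all_iff.2 fun i =>
      (hγ.absolutelyContinuousOnInterval ω (EuclideanSpace.single i (1 : ℝ)) T).ae_differentiableAt
  filter_upwards [h] with s hs hsT
  have hd : DifferentiableAt ℝ (fun s : ℝ => γ ω s.toNNReal) s := by
    rw [differentiableAt_euclidean]
    intro i
    simpa [EuclideanSpace.inner_single_left] using hs i hsT
  have := (hasDerivAt_const s p).inner ℝ hd.hasDerivAt
  rw [this.deriv]
  simp [velocity]

theorem IsAdmissible.intervalIntegrable_inner_velocity {m N : ℕ} {γ : PathSpace m → C(ℝ≥0, E N)}
    (hγ : IsAdmissible γ) (ω : PathSpace m) (p : E N) {a b : ℝ≥0} (hab : a ≤ b) :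
    IntervalIntegrable (fun s => inner ℝ p (velocity (γ ω) s)) volume a b := by
  have hsub : uIcc (a : ℝ) b ⊆ uIcc 0 b := uIcc_subset_uIcc
    (by rw [uIcc_of_le (NNReal.coe_nonneg b)]; exact ⟨a.2, hab⟩) right_mem_uIcc
  have h := ((hγ.absolutelyContinuousOnInterval ω p b).mono hsub).intervalIntegrable_deriv
  refine h.congr_ae ((ae_restrict_iff' measurableSet_uIoc).2 ?_)
  filter_upwards [hγ.ae_deriv_inner ω p b] with s hs hsab
  exact hs (hsub (uIoc_subset_uIcc hsab))

theorem IsAdmissible.integral_inner_velocity {m N : ℕ} {γ : PathSpace m → C(ℝ≥0, E N)}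
    (hγ : IsAdmissible γ) (ω : PathSpace m) (p : E N) {a b : ℝ≥0} (hab : a ≤ b) :
    ∫ s in (a : ℝ)..b, inner ℝ p (velocity (γ ω) s) = inner ℝ p (γ ω b - γ ω a) := by
  have hsub : uIcc (a : ℝ) b ⊆ uIcc 0 b := uIcc_subset_uIcc
    (by rw [uIcc_of_le (NNReal.coe_nonneg b)]; exact ⟨a.2, hab⟩) right_mem_uIcc
  have h := ((hγ.absolutelyContinuousOnInterval ω p b).mono hsub).integral_deriv_eq_sub
  rw [Real.toNNReal_coe, Real.toNNReal_coe, ← inner_sub_right] at h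
  rw [← h]
  refine intervalIntegral.integral_congr_ae ?_
  filter_upwards [hγ.ae_deriv_inner ω p b] with s hs hsab
  exact (hs (hsub (uIoc_subset_uIcc hsab))).symm

theorem IsAdmissible.exists_norm_sub_lt {m N : ℕ} {γ : PathSpace m → C(ℝ≥0, E N)}
    (hγ : IsAdmissible γ) (T : ℝ≥0) {ε : ℝ} (hε : 0 < ε) :
    ∃ δ : ℝ, 0 < δ ∧ ∀ a b : ℝ≥0, a ≤ b → b ≤ T → (b : ℝ) - a < δ →
      ∀ ω, ‖γ ω b - γ ω a‖ < ε := by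
  obtain ⟨δ, hδ, h⟩ := hγ.unifAC T ε hε
  refine ⟨δ, hδ, fun a b hab hb hlt ω => ?_⟩
  simpa using h 1 (fun _ => a) (fun _ => b) (fun _ => ⟨hab, hb⟩)
    (fun j k hjk => (hjk (Subsingleton.elim _ _)).elim) (by simpa using hlt) ω

/-- The values of an admissible curve on a bounded interval stay in a ball, uniformly in `ω`. -/
theorem IsAdmissible.exists_forall_norm_sub_le {m N : ℕ} {γ : PathSpace m → C(ℝ≥0, E N)}
    (hγ : IsAdmissible γ) (T : ℝ≥0) :
    ∃ R : ℝ, 0 ≤ R ∧ ∀ ω, ∀ s ≤ T, ‖γ ω s - γ ω 0‖ ≤ R := by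
  obtain ⟨δ, hδ, h⟩ := hγ.exists_norm_sub_lt T one_pos
  obtain ⟨n, hn⟩ := exists_nat_gt ((T : ℝ) / δ)
  -- The curve moves by less than 1 in each time step of length δ / 2, whatever ω.
  have key : ∀ k : ℕ, ∀ ω, ∀ s ≤ T, (s : ℝ) ≤ k * (δ / 2) → ‖γ ω s - γ ω 0‖ ≤ k := by
    intro k
    induction k with
    | zero =>
      intro ω s _ hs
      have : s = 0 := by
        rw [← NNReal.coe_eq_zero]
        exact le_antisymm (by simpa using hs) s.2
      simp [this]
    | succ k ih =>
      intro ω s hsT hs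
      set r : ℝ≥0 := s - (δ / 2).toNNReal with hr
      have hrs : r ≤ s := tsub_le_self
      have h2 : (s : ℝ) ≤ r + δ / 2 := by
        have := le_tsub_add (a := (δ / 2).toNNReal) (b := s)
        rw [← NNReal.coe_le_coe, NNReal.coe_add, Real.coe_toNNReal _ (by positivity)] at this
        exact this
      have h3 : (r : ℝ) ≤ k * (δ / 2) := by
        rw [hr, NNReal.coe_sub_def, Real.coe_toNNReal _ (by positivity)]
        refine max_le ?_ (by positivity)
        push_cast at hs
        linarith
      have h4 := h r s hrs hsT (by linarith) ω
      have h5 := ih ω r (hrs.trans hsT) h3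
      have h6 := norm_sub_le_norm_sub_add_norm_sub (γ ω s) (γ ω r) (γ ω 0)
      push_cast
      linarith
  refine ⟨(2 * n : ℕ), by positivity, fun ω s hs => key _ ω s hs ?_⟩
  rw [div_lt_iff₀ hδ] at hn
  have : (s : ℝ) ≤ T := hs
  push_cast
  linarith

/-! ### Short-time expansion of the transition probabilities -/

theorem hasDerivAt_exp_neg_smul_apply {m : ℕ} (B : Matrix (Fin m) (Fin m) ℝ) (l j : Fin m) :
    HasDerivAt (fun h : ℝ => NormedSpace.exp (-(h • B)) l j) (-B l j) 0 := by
  let _ := Matrix.linftyOpNormedRing (n := Fin m) (α := ℝ)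
  let _ := Matrix.linftyOpNormedAlgebra (n := Fin m) (R := ℝ) (α := ℝ)
  have h1 := hasDerivAt_exp_smul_const (𝕂 := ℝ) (-B) (0 : ℝ)
  let e : Matrix (Fin m) (Fin m) ℝ →L[ℝ] ℝ :=
    LinearMap.toContinuousLinearMap
      { toFun := fun A => A l j, map_add' := fun _ _ => rfl, map_smul' := fun _ _ => rfl }
  have h2 := e.hasFDerivAt.comp_hasDerivAt (0 : ℝ) h1
  have h3 : NormedSpace.exp ((0 : ℝ) • -B) * -B = -B := by
    rw [zero_smul, NormedSpace.exp_zero, one_mul]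
  have h4 : (fun h : ℝ => NormedSpace.exp (-(h • B)) l j) =
      fun h : ℝ => NormedSpace.exp (h • -B) l j := by simp only [smul_neg]
  rw [h4]
  exact h2.congr_deriv (congrArg e h3)

/-- The transition probability from `l` to `j` in time `h`. -/
noncomputable def transition {m : ℕ} (B : Matrix (Fin m) (Fin m) ℝ) (h : ℝ) (l j : Fin m) : ℝ≥0∞ :=
  ENNReal.ofReal (NormedSpace.exp (-(h • B)) l j)

theorem IsCoupling.exists_abs_transition_sub_le {m : ℕ} {B : Matrix (Fin m) (Fin m) ℝ}
    (hB : IsCoupling B) {ε : ℝ} (hε : 0 < ε) :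
    ∃ δ : ℝ, 0 < δ ∧ ∀ h, 0 < h → h < δ → ∀ l j,
      |(transition B h l j).toReal - ((1 : Matrix (Fin m) (Fin m) ℝ) l j - h * B l j)| ≤ ε * h := by
  have h1 : ∀ l j, ∀ᶠ h in 𝓝 (0 : ℝ), 0 < h →
      |(transition B h l j).toReal - ((1 : Matrix (Fin m) (Fin m) ℝ) l j - h * B l j)| ≤ ε * h := by
    intro l j
    have h2 := (hasDerivAt_iff_isLittleO.1 (hasDerivAt_exp_neg_smul_apply B l j)).def hε
    have h3 : ∀ᶠ h in 𝓝 (0 : ℝ), h * B l l < 1 := by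
      have : Tendsto (fun h : ℝ => h * B l l) (𝓝 0) (𝓝 (0 * B l l)) :=
        (continuous_id.mul continuous_const).tendsto 0
      rw [zero_mul] at this
      exact this.eventually_lt_const one_pos
    filter_upwards [h2, h3] with h h2 h3 hpos
    simp only [zero_smul, neg_zero, NormedSpace.exp_zero, sub_zero, smul_eq_mul,
      Real.norm_eq_abs, abs_of_pos hpos] at h2
    -- `ENNReal.ofReal` truncates at 0. The expansion 1 - hB is entrywise nonnegative for small h
    -- and truncation is 1-Lipschitz, so the estimate survives without knowing the sign of the
    -- exponential.
    have h4 : 0 ≤ (1 : Matrix (Fin m) (Fin m) ℝ) l j - h * B l j := by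
      by_cases hlj : j = l
      · subst hlj; simp; linarith
      · rw [Matrix.one_apply_ne' hlj]
        nlinarith [hB.offDiag l j hlj]
    rw [transition, ENNReal.toReal_ofReal', ← max_eq_left h4]
    refine (abs_max_sub_max_le_abs _ _ _).trans (le_of_eq_of_le ?_ h2)
    congr 1
    ring
  have h2 := eventually_all.2 fun l => eventually_all.2 fun j => h1 l j
  obtain ⟨δ, hδ, h3⟩ := Metric.eventually_nhds_iff.1 h2
  refine ⟨δ, hδ, fun h h0 hlt l j => h3 ?_ l j h0⟩
  rwa [Real.dist_eq, sub_zero, abs_of_pos h0]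

/-! ### Measurability and stopping on the path space -/

namespace PathSpace

theorem measurable_apply {m : ℕ} (t : ℝ≥0) : Measurable (fun ω : PathSpace m => ω t) :=
  Measurable.of_comap_le (le_iSup (fun t : ℝ≥0 =>
    MeasurableSpace.comap (fun ω : PathSpace m => ω t) ⊤) t)

theorem measurable_iff {m : ℕ} {α : Type*} [MeasurableSpace α] {f : α → PathSpace m} :
    Measurable f ↔ ∀ t : ℝ≥0, Measurable fun a => f a t := by
  refine ⟨fun h t => (measurable_apply t).comp h, fun h => ?_⟩
  refine Measurable.of_le_map (iSup_le fun t => ?_)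
  rw [← measurable_iff_comap_le]
  exact h t

theorem measurableSet_eq {m : ℕ} (t : ℝ≥0) (i : Fin m) :
    MeasurableSet {ω : PathSpace m | ω t = i} :=
  measurable_apply t (measurableSet_singleton i)

theorem measurableSet_ne {m : ℕ} (s t : ℝ≥0) :
    MeasurableSet {ω : PathSpace m | ω s ≠ ω t} :=
  (measurableSet_eq_fun (measurable_apply s) (measurable_apply t)).compl

theorem measurableSet_forall_eq {m : ℕ} (F : Finset ℝ≥0) (c : ℝ≥0 → Fin m) :
    MeasurableSet {ω : PathSpace m | ∀ r ∈ F, ω r = c r} := by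
  have : {ω : PathSpace m | ∀ r ∈ F, ω r = c r} = ⋂ r ∈ F, {ω : PathSpace m | ω r = c r} := by
    ext; simp
  rw [this]
  exact Finset.measurableSet_biInter _ fun r _ => measurableSet_eq r _

/-- The path `ω` stopped at time `s`. -/
def stopAt {m : ℕ} (s : ℝ≥0) (ω : PathSpace m) : PathSpace m :=
  ⟨fun r => ω (min r s), fun t => by
    refine ⟨(ω.2 (min t s)).1.comp (f := fun r => min r s) (by fun_prop)
      (fun r hr => min_le_min_right s hr), ?_⟩
    rcases le_or_gt t s with h | h
    · obtain ⟨l, hl⟩ := (ω.2 t).2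
      refine ⟨l, hl.congr' ?_⟩
      filter_upwards [self_mem_nhdsWithin] with r hr
      rw [min_eq_left (le_trans (le_of_lt hr) h)]
    · refine ⟨ω s, tendsto_const_nhds.congr' ?_⟩
      filter_upwards [Ioo_mem_nhdsLT h] with r hr
      rw [min_eq_right hr.1.le]⟩

theorem stopAt_apply {m : ℕ} (s : ℝ≥0) (ω : PathSpace m) (r : ℝ≥0) : stopAt s ω r = ω (min r s) := rfl

theorem stopAt_apply_of_le {m : ℕ} {s : ℝ≥0} (ω : PathSpace m) {r : ℝ≥0} (h : r ≤ s) :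
    stopAt s ω r = ω r := by rw [stopAt_apply, min_eq_left h]

theorem measurable_stopAt {m : ℕ} (s : ℝ≥0) : Measurable (stopAt (m := m) s) :=
  measurable_iff.2 fun t => measurable_apply (min t s)

/-- A finite measure on the path space is determined by its finite dimensional distributions. -/
theorem measure_ext {m : ℕ} {μ ν : Measure (PathSpace m)} [IsFiniteMeasure μ]
    (h : ∀ F : Finset ℝ≥0, μ.map (fun ω (r : F) => ω r) = ν.map (fun ω (r : F) => ω r)) :
    μ = ν := by
  have hv : Measurable (fun (ω : PathSpace m) (r : ℝ≥0) => ω r) :=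
    measurable_pi_iff.2 measurable_apply
  have h1 : μ.map (fun ω r => ω r) = ν.map (fun ω r => ω r) := by
    have : ∀ F : Finset ℝ≥0, IsFiniteMeasure (μ.map (fun ω (r : F) => ω r)) := fun F => inferInstance
    refine IsProjectiveLimit.unique (P := fun F : Finset ℝ≥0 => μ.map (fun ω (r : F) => ω r))
      (fun F => ?_) (fun F => ?_)
    · rw [Measure.map_map (Finset.measurable_restrict F) hv]; rfl
    · rw [Measure.map_map (Finset.measurable_restrict F) hv]; exact (h F).symm
  refine Measure.ext fun A hA => ?_
  -- Every event is the trace of an event of the full product space, where the projective limit is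
  -- unique.
  have h2 : (⨆ t : ℝ≥0, MeasurableSpace.comap (fun ω : PathSpace m => ω t) ⊤) ≤
      MeasurableSpace.comap (fun (ω : PathSpace m) (r : ℝ≥0) => ω r) MeasurableSpace.pi := by
    refine iSup_le fun t => ?_
    rw [← measurable_iff_comap_le]
    exact (measurable_pi_apply t).comp (comap_measurable _)
  obtain ⟨A', hA', rfl⟩ := h2 A hA
  rw [← Measure.map_apply hv hA', h1, Measure.map_apply hv hA']

end PathSpace

open PathSpace

/-! ### Markov property and generator -/

theorem IsMarkovChain.measure_cylinder_inter {m : ℕ} {B : Matrix (Fin m) (Fin m) ℝ}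
    {P : Measure (PathSpace m)} [IsFiniteMeasure P] (hP : IsMarkovChain B P) {F : Finset ℝ≥0}
    {s s' : ℝ≥0} (hF : ∀ r ∈ F, r ≤ s) (hsF : s ∈ F) (hss' : s < s') (c : ℝ≥0 → Fin m)
    (j : Fin m) :
    P ({ω | ∀ r ∈ F, ω r = c r} ∩ {ω | ω s' = j}) =
      transition B (s' - s) (c s) j * P {ω | ∀ r ∈ F, ω r = c r} := by
  by_cases h0 : P {ω | ∀ r ∈ F, ω r = c r} = 0
  · rw [h0, mul_zero]
    exact measure_mono_null inter_subset_left h0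
  obtain ⟨k, hk⟩ : ∃ k, F.card = k + 1 :=
    ⟨F.card - 1, (Nat.sub_add_cancel (Finset.card_pos.2 ⟨s, hsF⟩)).symm⟩
  set e := F.orderEmbOfFin hk with he
  have hset : {ω : PathSpace m | ∀ r ∈ F, ω r = c r} = {ω | ∀ i : Fin (k + 1), ω (e i) = c (e i)} := by
    ext ω
    refine ⟨fun h i => h _ (F.orderEmbOfFin_mem hk i), fun h r hr => ?_⟩
    have : r ∈ Set.range e := by rw [he, Finset.range_orderEmbOfFin]; exact hr
    obtain ⟨i, rfl⟩ := this
    exact h i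
  have hlast : e (Fin.last k) = s := by
    refine le_antisymm (hF _ (F.orderEmbOfFin_mem hk _)) ?_
    have : s ∈ Set.range e := by rw [he, Finset.range_orderEmbOfFin]; exact hsF
    obtain ⟨i, hi⟩ := this
    rw [← hi]
    exact e.monotone (Fin.le_last i)
  -- The times of F in increasing order end at s; appending s' gives the tuple to which the
  -- definition of a Markov chain applies.
  have hmono : StrictMono (Fin.snoc e s' : Fin (k + 2) → ℝ≥0) := by
    intro a b hab
    induction b using Fin.lastCases with
    | last =>
      induction a using Fin.lastCases with
      | last => exact absurd hab (lt_irrefl _)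
      | cast a => simpa using (hF _ (F.orderEmbOfFin_mem hk a)).trans_lt hss'
    | cast b =>
      induction a using Fin.lastCases with
      | last => exact absurd hab (not_lt.2 (Fin.le_last _))
      | cast a => simpa using hab
  have h1 := hP k (Fin.snoc e s') (Fin.snoc (fun i => c (e i)) j) hmono
  simp only [Fin.snoc_castSucc, Fin.snoc_last, hlast] at h1
  rw [← hset] at h1
  have h2 := h1 h0
  rw [ProbabilityTheory.cond_apply (measurableSet_forall_eq F c)] at h2
  rw [transition, ← h2, mul_comm, ← mul_assoc, ENNReal.mul_inv_cancel h0 (measure_ne_top _ _),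
    one_mul]

/-- The Markov property, for the law of the path up to time `s`. -/
theorem IsMarkovChain.map_stopAt_restrict {m : ℕ} {B : Matrix (Fin m) (Fin m) ℝ}
    {P : Measure (PathSpace m)} [IsFiniteMeasure P] (hP : IsMarkovChain B P) {s s' : ℝ≥0}
    (hss' : s < s') (l j : Fin m) :
    (P.restrict ({ω | ω s = l} ∩ {ω | ω s' = j})).map (stopAt s) =
      (transition B (s' - s) l j • P.restrict {ω | ω s = l}).map (stopAt s) := by
  refine measure_ext fun F => ?_
  have hm : Measurable (fun (ω : PathSpace m) (r : F) => ω r) :=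
    measurable_pi_iff.2 fun r => measurable_apply r
  rw [Measure.map_map hm (measurable_stopAt s), Measure.map_map hm (measurable_stopAt s)]
  refine Measure.ext_of_singleton fun c => ?_
  have hm' := hm.comp (measurable_stopAt (m := m) s)
  rw [Measure.map_apply hm' (measurableSet_singleton c),
    Measure.map_apply hm' (measurableSet_singleton c), Measure.smul_apply, smul_eq_mul,
    Measure.restrict_apply (hm' (measurableSet_singleton c)),
    Measure.restrict_apply (hm' (measurableSet_singleton c)), ← inter_assoc]
  set A := (((fun (ω : PathSpace m) (r : F) => ω r) ∘ stopAt s) ⁻¹' {c}) ∩ {ω | ω s = l} with hA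
  rcases A.eq_empty_or_nonempty with h0 | ⟨ω₀, hω₀, hl⟩
  · simp [h0]
  -- Stopping replaces each time r by min r s, so a nonempty A is a cylinder with times up to s, its
  -- values being read off any ω₀ in A.
  have hAeq : A = {ω | ∀ r ∈ insert s (F.image (min · s)), ω r = ω₀ r} := by
    ext ω
    simp only [hA, mem_inter_iff, mem_preimage, mem_singleton_iff, Function.comp_apply, mem_ofPred_eq,
      Finset.forall_mem_insert, Finset.forall_mem_image] at hω₀ hl ⊢
    rw [hl, ← hω₀, and_comm, funext_iff]
    simp only [Subtype.forall]
    rfl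
  have := hP.measure_cylinder_inter (F := insert s (F.image (min · s))) (s := s) ?_
    (Finset.mem_insert_self _ _) hss' ω₀ j
  · rw [hAeq, this]
    rw [mem_ofPred_eq] at hl
    rw [hl]
  · simp

/-- Invariance under `stopAt s` expresses that Y depends only on the past up to s, so its integrals
see only the law of the stopped path. -/
theorem IsMarkovChain.setIntegral_inter {m : ℕ} {B : Matrix (Fin m) (Fin m) ℝ}
    {P : Measure (PathSpace m)} [IsFiniteMeasure P] (hP : IsMarkovChain B P) {s s' : ℝ≥0}
    (hss' : s < s') (l j : Fin m) {Y : PathSpace m → ℝ} (hY : Measurable Y)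
    (hYs : ∀ ω, Y (stopAt s ω) = Y ω) :
    ∫ ω in {ω | ω s = l} ∩ {ω | ω s' = j}, Y ω ∂P =
      (transition B (s' - s) l j).toReal * ∫ ω in {ω | ω s = l}, Y ω ∂P := by
  have h1 : ∀ μ : Measure (PathSpace m), ∫ ω, Y ω ∂μ = ∫ ω, Y ω ∂(μ.map (stopAt s)) := by
    intro μ
    rw [integral_map (measurable_stopAt s).aemeasurable hY.aestronglyMeasurable]
    simp only [hYs]
  rw [h1, hP.map_stopAt_restrict hss', ← h1, integral_smul_measure, smul_eq_mul]

/-- The starting state belongs to the past, so its indicator can be absorbed into Y. -/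
theorem IsMarkovChain.setIntegral_inter_condStart {m : ℕ} {B : Matrix (Fin m) (Fin m) ℝ}
    {P : Measure (PathSpace m)} [IsFiniteMeasure P] (hP : IsMarkovChain B P) {s s' : ℝ≥0}
    (hss' : s < s') (i l j : Fin m) {Y : PathSpace m → ℝ} (hY : Measurable Y)
    (hYs : ∀ ω, Y (stopAt s ω) = Y ω) :
    ∫ ω in {ω | ω s = l} ∩ {ω | ω s' = j}, Y ω ∂(condStart P i) =
      (transition B (s' - s) l j).toReal * ∫ ω in {ω | ω s = l}, Y ω ∂(condStart P i) := by
  have hi : MeasurableSet (startsAt (m := m) i) := measurableSet_eq 0 i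
  have h1 : ∀ A : Set (PathSpace m), MeasurableSet A → ∫ ω in A, Y ω ∂(condStart P i) =
      (P (startsAt i))⁻¹.toReal * ∫ ω in A, (startsAt i).indicator Y ω ∂P := by
    intro A hA
    rw [condStart, ProbabilityTheory.cond, Measure.restrict_smul, integral_smul_measure,
      Measure.restrict_restrict hA, setIntegral_indicator hi, smul_eq_mul]
  rw [h1 _ ((measurableSet_eq s l).inter (measurableSet_eq s' j)), h1 _ (measurableSet_eq s l),
    hP.setIntegral_inter hss' l j (hY.indicator hi)]
  · ring
  · intro ω
    have : stopAt s ω ∈ startsAt i ↔ ω ∈ startsAt i := by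
      simp only [startsAt, mem_ofPred_eq, stopAt_apply_of_le ω (zero_le : 0 ≤ s)]
    by_cases h : ω ∈ startsAt i
    · rw [indicator_of_mem h, indicator_of_mem (this.2 h), hYs]
    · rw [indicator_of_notMem h, indicator_of_notMem (fun h' => h (this.1 h'))]

theorem isProbabilityMeasure_condStart {m : ℕ} {P : Measure (PathSpace m)} [IsFiniteMeasure P]
    {i : Fin m} (h : P (startsAt i) ≠ 0) : IsProbabilityMeasure (condStart P i) :=
  ProbabilityTheory.cond_isProbabilityMeasure h

/-- The infinitesimal generator of the chain is `-B`, conditionally to the past. -/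
theorem IsMarkovChain.exists_abs_integral_generator_le {m : ℕ} {B : Matrix (Fin m) (Fin m) ℝ}
    {P : Measure (PathSpace m)} [IsFiniteMeasure P] (hP : IsMarkovChain B P) (hB : IsCoupling B)
    {ε : ℝ} (hε : 0 < ε) :
    ∃ δ : ℝ, 0 < δ ∧ ∀ s s' : ℝ≥0, s < s' → (s' : ℝ) - s < δ → ∀ (Y : Fin m → PathSpace m → ℝ)
      (M : ℝ), (∀ j, Measurable (Y j)) → (∀ j ω, Y j (stopAt s ω) = Y j ω) → (∀ j ω, |Y j ω| ≤ M) →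
      ∀ i, P (startsAt i) ≠ 0 → |∫ ω, (Y (ω s') ω - Y (ω s) ω +
        ((s' : ℝ) - s) * ∑ j, B (ω s) j * Y j ω) ∂(condStart P i)| ≤ ε * ((s' : ℝ) - s) * M := by
  obtain ⟨δ, hδ, h⟩ := hB.exists_abs_transition_sub_le (ε := ε / ((m : ℝ) * m + 1)) (by positivity)
  refine ⟨δ, hδ, fun s s' hss' hlt Y M hY hYs hM i hi => ?_⟩
  have hpos : 0 < (s' : ℝ) - s := sub_pos.2 hss'
  have := isProbabilityMeasure_condStart hi
  set μ := condStart P i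
  set A : Fin m → Set (PathSpace m) := fun l => {ω | ω s = l}
  set A' : Fin m → Set (PathSpace m) := fun l => {ω | ω s' = l}
  have hA : ∀ l, MeasurableSet (A l) := measurableSet_eq s
  have hA' : ∀ l, MeasurableSet (A' l) := measurableSet_eq s'
  have hYi : ∀ j, Integrable (Y j) μ := fun j =>
    Integrable.of_bound (hY j).aestronglyMeasurable M (ae_of_all _ (hM j))
  -- Splitting by the states l at s and j at s' turns each mean into (transition probability minus
  -- its first-order expansion) times an integral over the past.
  have h1 : ∀ ω : PathSpace m, Y (ω s') ω - Y (ω s) ω + ((s' : ℝ) - s) * ∑ j, B (ω s) j * Y j ω =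
      ∑ l, ∑ j, ((A l ∩ A' j).indicator (Y j) ω -
        ((1 : Matrix (Fin m) (Fin m) ℝ) l j - (s' - s) * B l j) * (A l).indicator (Y j) ω) := by
    intro ω
    symm
    refine (Finset.sum_eq_single (ω s) ?_ (by simp)).trans ?_
    · intro l _ hl
      have h2 : ω ∉ A l := fun hω => hl hω.symm
      refine Finset.sum_eq_zero fun j _ => ?_
      rw [indicator_of_notMem h2, indicator_of_notMem (fun h => h2 h.1)]
      ring
    · have h2 : ∀ j, (A (ω s)).indicator (Y j) ω = Y j ω := fun j =>
        indicator_of_mem (show ω ∈ A (ω s) from rfl) _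
      have h5 : ∑ j, (A (ω s) ∩ A' j).indicator (Y j) ω = Y (ω s') ω := by
        refine (Finset.sum_eq_single (ω s') ?_ (by simp)).trans ?_
        · intro j _ hj
          exact indicator_of_notMem (fun hω => hj hω.2.symm) _
        · exact indicator_of_mem (show ω ∈ A (ω s) ∩ A' (ω s') from ⟨rfl, rfl⟩) _
      simp only [Finset.sum_sub_distrib, h5, h2, sub_mul, Matrix.one_apply, ite_mul, one_mul,
        zero_mul, Finset.sum_ite_eq, Finset.mem_univ, if_true, mul_assoc, ← Finset.mul_sum]
      ring
  have hint : ∀ l j, Integrable (fun ω => (A l ∩ A' j).indicator (Y j) ω -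
      ((1 : Matrix (Fin m) (Fin m) ℝ) l j - (s' - s) * B l j) * (A l).indicator (Y j) ω) μ :=
    fun l j => ((hYi j).indicator ((hA l).inter (hA' j))).sub
      (((hYi j).indicator (hA l)).const_mul _)
  simp only [h1]
  rw [integral_finsetSum _ fun l _ => integrable_finsetSum _ fun j _ => hint l j]
  have h3 : ∀ l, ∫ ω, ∑ j, ((A l ∩ A' j).indicator (Y j) ω -
        ((1 : Matrix (Fin m) (Fin m) ℝ) l j - (s' - s) * B l j) * (A l).indicator (Y j) ω) ∂μ =
      ∑ j, ((transition B (s' - s) l j).toReal -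
        ((1 : Matrix (Fin m) (Fin m) ℝ) l j - (s' - s) * B l j)) * ∫ ω in A l, Y j ω ∂μ := by
    intro l
    rw [integral_finsetSum _ fun j _ => hint l j]
    refine Finset.sum_congr rfl fun j _ => ?_
    rw [integral_sub ((hYi j).indicator ((hA l).inter (hA' j)))
      (((hYi j).indicator (hA l)).const_mul _), integral_const_mul, integral_indicator (hA l),
      integral_indicator ((hA l).inter (hA' j)),
      hP.setIntegral_inter_condStart hss' i l j (hY j) (hYs j)]
    ring
  simp only [h3]
  have h4 : ∀ l j, |((transition B (s' - s) l j).toReal -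
      ((1 : Matrix (Fin m) (Fin m) ℝ) l j - (s' - s) * B l j)) * ∫ ω in A l, Y j ω ∂μ| ≤
      ε / ((m : ℝ) * m + 1) * (s' - s) * M := by
    intro l j
    have hM0 : 0 ≤ M := (abs_nonneg _).trans (hM l (Classical.choice
      (nonempty_of_isProbabilityMeasure μ)))
    rw [abs_mul]
    refine mul_le_mul (h _ hpos hlt l j) ?_ (abs_nonneg _) (by positivity)
    have h5 := norm_setIntegral_le_of_norm_le_const (μ := μ) (s := A l) (f := Y j) (C := M)
      (measure_lt_top _ _) fun ω _ => hM j ω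
    refine h5.trans ?_
    exact mul_le_of_le_one_right hM0 measureReal_le_one
  calc _ ≤ ∑ l : Fin m, ∑ j : Fin m, ε / ((m : ℝ) * m + 1) * (s' - s) * M :=
        (Finset.abs_sum_le_sum_abs _ _).trans (Finset.sum_le_sum fun l _ =>
          (Finset.abs_sum_le_sum_abs _ _).trans (Finset.sum_le_sum fun j _ => h4 l j))
    _ = (m : ℝ) * m / ((m : ℝ) * m + 1) * (ε * (s' - s) * M) := by
        simp only [Finset.sum_const, Finset.card_univ, Fintype.card_fin, nsmul_eq_mul]
        ring
    _ ≤ 1 * (ε * (s' - s) * M) := by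
        have hM0 : 0 ≤ M := (abs_nonneg _).trans (hM i (Classical.choice
          (nonempty_of_isProbabilityMeasure μ)))
        refine mul_le_mul_of_nonneg_right ?_ (by positivity)
        rw [div_le_one (by positivity)]
        linarith
    _ = _ := one_mul _

/-! ### Probability of a jump in a short interval -/

theorem IsMarkovChain.exists_measureReal_ne_le {m : ℕ} {B : Matrix (Fin m) (Fin m) ℝ}
    {P : Measure (PathSpace m)} [IsFiniteMeasure P] (hP : IsMarkovChain B P) (hB : IsCoupling B) :
    ∃ C δ : ℝ, 0 ≤ C ∧ 0 < δ ∧ ∀ s s' : ℝ≥0, s < s' → (s' : ℝ) - s < δ →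
      ∀ i, P (startsAt i) ≠ 0 →
        (condStart P i).real {ω | ω s ≠ ω s'} ≤ C * ((s' : ℝ) - s) := by
  obtain ⟨δ, hδ, h⟩ := hB.exists_abs_transition_sub_le one_pos
  refine ⟨∑ l, ∑ j, (|B l j| + 1), δ, by positivity, hδ, fun s s' hss' hlt i hi => ?_⟩
  have hpos : 0 < (s' : ℝ) - s := sub_pos.2 hss'
  have := isProbabilityMeasure_condStart hi
  set μ := condStart P i
  have hsub : {ω : PathSpace m | ω s ≠ ω s'} ⊆ ⋃ l ∈ (Finset.univ : Finset (Fin m)),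
      ⋃ j ∈ (Finset.univ.erase l : Finset (Fin m)), ({ω | ω s = l} ∩ {ω | ω s' = j}) := by
    intro ω hω
    simp only [mem_iUnion, Finset.mem_univ, Finset.mem_erase]
    exact ⟨ω s, trivial, ω s', ⟨fun h => hω h.symm, trivial⟩, rfl, rfl⟩
  have h1 : ∀ l j, j ≠ l → μ.real ({ω | ω s = l} ∩ {ω | ω s' = j}) ≤ (|B l j| + 1) * (s' - s) := by
    intro l j hlj
    have h2 := hP.setIntegral_inter_condStart hss' i l j (Y := fun _ => 1) measurable_const
      (fun _ => rfl)
    simp only [setIntegral_const, smul_eq_mul, mul_one] at h2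
    rw [h2]
    have h3 := h _ hpos hlt l j
    rw [Matrix.one_apply_ne' hlj] at h3
    have h4 := (abs_le.1 h3).2
    have h5 : -B l j ≤ |B l j| := neg_le_abs _
    have h6 : (transition B (s' - s) l j).toReal ≤ (|B l j| + 1) * (s' - s) := by nlinarith
    exact (mul_le_of_le_one_right ENNReal.toReal_nonneg measureReal_le_one).trans h6
  calc μ.real {ω | ω s ≠ ω s'} ≤ _ := measureReal_mono hsub (measure_ne_top _ _)
    _ ≤ ∑ l, ∑ j ∈ Finset.univ.erase l, μ.real ({ω | ω s = l} ∩ {ω | ω s' = j}) :=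
        (measureReal_biUnion_finset_le _ _).trans (Finset.sum_le_sum fun l _ =>
          measureReal_biUnion_finset_le _ _)
    _ ≤ ∑ l, ∑ j ∈ Finset.univ.erase l, (|B l j| + 1) * (s' - s) :=
        Finset.sum_le_sum fun l _ => Finset.sum_le_sum fun j hj => h1 l j (Finset.ne_of_mem_erase hj)
    _ ≤ ∑ l, ∑ j, (|B l j| + 1) * (s' - s) :=
        Finset.sum_le_sum fun l _ => Finset.sum_le_sum_of_subset_of_nonneg (Finset.erase_subset _ _)
          fun j _ _ => by positivity
    _ = _ := by simp only [Finset.sum_mul]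

/-- The paths that are not constant on the dyadic points of level `n` of `[s, s + h]`. -/
def dyadicJump (m : ℕ) (s h : ℝ≥0) (n : ℕ) : Set (PathSpace m) :=
  {ω | ∃ k : ℕ, k ≤ 2 ^ n ∧ ω (s + k * (h / 2 ^ n)) ≠ ω s}

/-- The paths that are not constant on `[s, s + h]`. -/
def jump (m : ℕ) (s h : ℝ≥0) : Set (PathSpace m) := ⋃ n, dyadicJump m s h n

theorem measurableSet_jump (m : ℕ) (s h : ℝ≥0) : MeasurableSet (jump m s h) := by
  refine MeasurableSet.iUnion fun n => ?_
  have : dyadicJump m s h n =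
      ⋃ k ∈ Finset.Iic (2 ^ n : ℕ), {ω : PathSpace m | ω (s + k * (h / 2 ^ n)) ≠ ω s} := by
    ext ω
    simp [dyadicJump]
  rw [this]
  exact Finset.measurableSet_biUnion _ fun k _ => measurableSet_ne _ _

theorem monotone_dyadicJump (m : ℕ) (s h : ℝ≥0) : Monotone (dyadicJump m s h) := by
  refine monotone_nat_of_le_succ fun n => ?_
  rintro ω ⟨k, hk, hω⟩
  refine ⟨2 * k, by rw [pow_succ]; omega, ?_⟩
  have h1 : ((2 * k : ℕ) : ℝ≥0) * (h / 2 ^ (n + 1)) = k * (h / 2 ^ n) := by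
    push_cast
    rw [pow_succ]
    field_simp
  rwa [h1]

/-- Dyadic points converge to r from the right, and ω is right continuous with discrete values.
Countably many times therefore detect every change of state. -/
theorem apply_eq_of_notMem_jump {m : ℕ} {s h : ℝ≥0} (hh : 0 < h) {ω : PathSpace m}
    (hω : ω ∉ jump m s h) {r : ℝ≥0} (hsr : s ≤ r) (hrs : r ≤ s + h) : ω r = ω s := by
  simp only [jump, dyadicJump, mem_iUnion, mem_ofPred_eq, not_exists, not_and, not_not] at hω
  have h2 : ∀ n : ℕ, (0 : ℝ≥0) < h / 2 ^ n := fun n => by positivity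
  set k : ℕ → ℕ := fun n => ⌈(r - s) / (h / 2 ^ n)⌉₊ with hk
  have hk1 : ∀ n, k n ≤ 2 ^ n := by
    intro n
    refine Nat.ceil_le.2 ?_
    rw [div_le_iff₀ (h2 n)]
    push_cast
    rw [mul_div_cancel₀ _ (by positivity)]
    exact tsub_le_iff_left.2 hrs
  have hk2 : ∀ n, r ≤ s + k n * (h / 2 ^ n) := by
    intro n
    rw [← tsub_le_iff_left, ← div_le_iff₀ (h2 n)]
    exact Nat.le_ceil _
  have hk3 : ∀ n, s + k n * (h / 2 ^ n) ≤ r + h / 2 ^ n := by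
    intro n
    have h3 := (Nat.ceil_lt_add_one (a := (r - s) / (h / 2 ^ n)) (zero_le)).le
    have h4 := mul_le_mul_of_nonneg_right h3 (h2 n).le
    rw [add_mul, one_mul, div_mul_cancel₀ _ (h2 n).ne'] at h4
    calc s + k n * (h / 2 ^ n) ≤ s + (r - s + h / 2 ^ n) := by gcongr
      _ = r + h / 2 ^ n := by rw [← add_assoc, add_tsub_cancel_of_le hsr]
  have hlim : Tendsto (fun n => s + k n * (h / 2 ^ n)) atTop (𝓝 r) := by
    refine tendsto_of_tendsto_of_tendsto_of_le_of_le tendsto_const_nhds ?_ hk2 hk3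
    have h5 : Tendsto (fun n : ℕ => r + h * (1 / 2) ^ n) atTop (𝓝 (r + h * 0)) :=
      ((NNReal.tendsto_pow_atTop_nhds_zero_of_lt_one (by
        rw [← NNReal.coe_lt_coe]; norm_num)).const_mul h).const_add r
    simp only [mul_zero, add_zero, one_div, inv_pow, ← div_eq_mul_inv] at h5
    exact h5
  have hlim' : Tendsto (fun n => s + k n * (h / 2 ^ n)) atTop (𝓝[≥] r) :=
    tendsto_nhdsWithin_iff.2 ⟨hlim, Eventually.of_forall hk2⟩
  have h6 := ((ω.2 r).1.tendsto.comp hlim').eventually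
    ((isOpen_discrete {ω r}).mem_nhds (mem_singleton _))
  obtain ⟨n, hn⟩ := h6.exists
  rw [← hω n (k n) (hk1 n)]
  exact hn.symm

/-- At level n there are 2^n consecutive pairs, each changing state with probability at most Ch /
2^n. The bound Ch is uniform in n and passes to the increasing union. -/
theorem IsMarkovChain.exists_measureReal_jump_le {m : ℕ} {B : Matrix (Fin m) (Fin m) ℝ}
    {P : Measure (PathSpace m)} [IsFiniteMeasure P] (hP : IsMarkovChain B P) (hB : IsCoupling B) :
    ∃ C δ : ℝ, 0 ≤ C ∧ 0 < δ ∧ ∀ s h : ℝ≥0, 0 < h → (h : ℝ) < δ →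
      ∀ i, P (startsAt i) ≠ 0 → (condStart P i).real (jump m s h) ≤ C * h := by
  obtain ⟨C, δ, hC, hδ, hCδ⟩ := hP.exists_measureReal_ne_le hB
  refine ⟨C, δ, hC, hδ, fun s h hh hlt i hi => ?_⟩
  have := isProbabilityMeasure_condStart hi
  set μ := condStart P i
  have h1 : ∀ n, μ.real (dyadicJump m s h n) ≤ C * h := by
    intro n
    have h2 : (0 : ℝ≥0) < h / 2 ^ n := by positivity
    have hsub : dyadicJump m s h n ⊆ ⋃ k ∈ Finset.range (2 ^ n),
        {ω : PathSpace m | ω (s + (k : ℕ) * (h / 2 ^ n)) ≠ ω (s + (k + 1 : ℕ) * (h / 2 ^ n))} := by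
      rintro ω ⟨k, hk, hω⟩
      by_contra hcon
      simp only [mem_iUnion, Finset.mem_range, mem_ofPred_eq, not_exists, ne_eq, not_not] at hcon
      refine hω ?_
      clear hω
      induction k with
      | zero => simp
      | succ k ih => rw [← hcon k (by omega)]; exact ih (by omega)
    calc μ.real (dyadicJump m s h n) ≤ _ := measureReal_mono hsub (measure_ne_top _ _)
      _ ≤ _ := measureReal_biUnion_finset_le _ _
      _ ≤ ∑ k ∈ Finset.range (2 ^ n), C * ((h : ℝ) / 2 ^ n) := by
        refine Finset.sum_le_sum fun k _ => ?_
        have h3 : ((s + (k + 1 : ℕ) * (h / 2 ^ n) : ℝ≥0) : ℝ) - ((s + (k : ℕ) * (h / 2 ^ n) : ℝ≥0) : ℝ)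
            = h / 2 ^ n := by push_cast; ring
        have h4 := hCδ (s + (k : ℕ) * (h / 2 ^ n)) (s + (k + 1 : ℕ) * (h / 2 ^ n)) ?_ ?_ i hi
        · rwa [h3] at h4
        · push_cast
          gcongr
          exact lt_add_one _
        · rw [h3]
          refine lt_of_le_of_lt (div_le_self h.2 ?_) hlt
          exact one_le_pow₀ (by norm_num)
      _ = C * h := by
        rw [Finset.sum_const, Finset.card_range, nsmul_eq_mul]
        push_cast
        field_simp
  have h2 := tendsto_measure_iUnion_atTop (μ := μ) (monotone_dyadicJump m s h)
  have h3 := (ENNReal.tendsto_toReal (measure_ne_top μ _)).comp h2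
  exact le_of_tendsto' h3 h1

/-! ### Pathwise estimate over one time step -/

theorem uscEnvelope_eq_of_pos {N m : ℕ} {u : ℝ × E N → Fin m → ℝ}
    (hu : ContinuousOn u (Ici (0 : ℝ) ×ˢ univ)) {z : ℝ × E N} (hz : 0 < z.1) :
    uscEnvelope u z = u z := by
  have h1 : ContinuousAt u z :=
    hu.continuousAt (prod_mem_nhds (Ici_mem_nhds hz) univ_mem)
  funext i
  exact ((continuous_apply i).continuousAt.comp h1).tendsto.limsup_eq

/-- For continuous functions the viscosity inequality holds without envelopes. -/
theorem IsSubsolution.le_of_mem_superdifferential {N m : ℕ} {H : Fin m → E N → E N → ℝ}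
    {B : Matrix (Fin m) (Fin m) ℝ} {u : ℝ × E N → Fin m → ℝ} (hsub : IsSubsolution H B u)
    (hu : ContinuousOn u (Ici (0 : ℝ) ×ˢ univ)) {z : ℝ × E N} (hz : 0 < z.1) (i : Fin m)
    {r : ℝ × E N} (hr : r ∈ superdifferential (fun y => u y i) z) :
    r.1 + H i z.2 r.2 + B.mulVec (u z) i ≤ 0 := by
  have h := hsub.visc z hz i r ?_
  · rwa [uscEnvelope_eq_of_pos hu hz] at h
  · obtain ⟨φ, hφ, hmax, h1, h2⟩ := hr
    refine ⟨φ, hφ, ?_, h1, h2⟩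
    refine hmax.congr ?_
    filter_upwards [continuous_fst.continuousAt.eventually (lt_mem_nhds hz)] with y hy
    rw [uscEnvelope_eq_of_pos hu hy]

/-- The increment of a Lipschitz continuous subsolution over a short segment. -/
theorem IsSubsolution.exists_increment_le {N m : ℕ} {H : Fin m → E N → E N → ℝ}
    {B : Matrix (Fin m) (Fin m) ℝ} {u : ℝ × E N → Fin m → ℝ} (hsub : IsSubsolution H B u)
    (hu : ContinuousOn u (Ici (0 : ℝ) ×ˢ univ)) {K : ℝ≥0} {τ σ ε η κ : ℝ} {ξ ζ : E N}
    (hτ : 0 ≤ τ) (hτσ : τ < σ) (hε : 0 < ε) (hη : 0 < η) (hζ : ‖ζ - ξ‖ ≤ ε)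
    (hLip : LipschitzOnWith K u (Icc τ σ ×ˢ Metric.closedBall ξ (2 * ε))) (j : Fin m)
    (hH : ∀ y ∈ Metric.closedBall ξ (2 * ε), ∀ p : E N, ‖p‖ ≤ 2 * K →
      |H j y p - H j ξ p| ≤ η)
    (hB : ∀ z ∈ Icc τ σ ×ˢ Metric.closedBall ξ (2 * ε),
      |B.mulVec (u z) j - B.mulVec (u (τ, ξ)) j| ≤ κ) :
    ∃ p : E N, ‖p‖ ≤ 2 * K ∧ u (σ, ξ) j - u (τ, ζ) j ≤ inner ℝ p (ξ - ζ) -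
      (σ - τ) * (H j ξ p + B.mulVec (u (τ, ξ)) j - (2 * η + κ)) := by
  have hpos : 0 < σ - τ := sub_pos.2 hτσ
  have hLj : LipschitzOnWith K (fun z => u z j) (Icc τ σ ×ˢ Metric.closedBall ξ (2 * ε)) := by
    have := (LipschitzWith.eval j : LipschitzWith 1 fun f : Fin m → ℝ => f j).comp_lipschitzOnWith hLip
    rwa [one_mul] at this
  -- The slack (σ - τ)η is proportional to the step and gives one η of the 2η; the other is the
  -- oscillation of H. The point z has time strictly above τ, so the viscosity inequality is
  -- available even when τ = 0.
  obtain ⟨z, hz, r, hr, hrK, hle⟩ := exists_mem_superdifferential_le (x := ζ) (y := ξ) (c := ξ)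
    (ρ := ε) hτσ (by rwa [Metric.mem_closedBall, dist_eq_norm]) (Metric.mem_closedBall_self hε.le)
    (by linarith) hLj (mul_pos hpos hη)
  have hzQ : z ∈ Icc τ σ ×ˢ Metric.closedBall ξ (2 * ε) :=
    ⟨Ioo_subset_Icc_self hz.1, Metric.ball_subset_closedBall hz.2⟩
  have h1 := hsub.le_of_mem_superdifferential hu (hτ.trans_lt hz.1.1) j hr
  have h2 := (abs_le.1 (hH z.2 hzQ.2 r.2 hrK)).1
  have h3 := (abs_le.1 (hB z hzQ)).1
  refine ⟨r.2, hrK, ?_⟩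
  have h4 : (σ - τ) * r.1 ≤
      (σ - τ) * (-(H j ξ r.2 + B.mulVec (u (τ, ξ)) j - (η + κ))) :=
    mul_le_mul_of_nonneg_left (by linarith) hpos.le
  nlinarith

/-- A lower bound of the action along a partition. -/
theorem IsAdmissible.sum_le_action {m N : ℕ} {γ : PathSpace m → C(ℝ≥0, E N)}
    (hγ : IsAdmissible γ) {H : Fin m → E N → E N → ℝ} (ω : PathSpace m) {s : ℕ → ℝ≥0}
    (hs : Monotone s) (hs0 : s 0 = 0) (p : ℕ → E N) (c : ℕ → ℝ) (n : ℕ)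
    (h : ∀ k < n, ∀ r ∈ Ioc (s k : ℝ) (s (k + 1)), inner ℝ (p k) (-velocity (γ ω) r) - c k ≤
      lagrangian (H (ω r.toNNReal)) (γ ω r.toNNReal) (-velocity (γ ω) r)) :
    ((∑ k ∈ Finset.range n, (inner ℝ (p k) (γ ω (s k) - γ ω (s (k + 1))) -
      ((s (k + 1) : ℝ) - s k) * c k) : ℝ) : EReal) ≤ action H ω (γ ω) (s n) := by
  -- The affine lower bounds of the cells are glued into one integrable minorant of the Lagrangian.
  obtain ⟨g, hg, hgi, hgle⟩ : ∃ g : ℝ → ℝ, IntervalIntegrable g volume 0 (s n) ∧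
      ∫ r in (0 : ℝ)..(s n), g r = ∑ k ∈ Finset.range n,
        (inner ℝ (p k) (γ ω (s k) - γ ω (s (k + 1))) - ((s (k + 1) : ℝ) - s k) * c k) ∧
      ∀ r ∈ Ioc (0 : ℝ) (s n), g r ≤
        lagrangian (H (ω r.toNNReal)) (γ ω r.toNNReal) (-velocity (γ ω) r) := by
    induction n with
    | zero => exact ⟨0, by simp [hs0], by simp [hs0], by simp [hs0]⟩
    | succ n ih =>
      obtain ⟨g, hg, hgi, hgle⟩ := ih fun k hk => h k (hk.trans n.lt_succ_self)
      have hle : s n ≤ s (n + 1) := hs n.le_succ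
      have hle' : (s n : ℝ) ≤ s (n + 1) := hle
      set q : ℝ → ℝ := fun r => inner ℝ (p n) (-velocity (γ ω) r) - c n with hq
      have hqi : IntervalIntegrable q volume (s n) (s (n + 1)) := by
        refine IntervalIntegrable.sub ?_ intervalIntegrable_const
        simp only [inner_neg_right]
        exact (hγ.intervalIntegrable_inner_velocity ω (p n) hle).neg
      have hqint : ∫ r in (s n : ℝ)..(s (n + 1)), q r =
          inner ℝ (p n) (γ ω (s n) - γ ω (s (n + 1))) - ((s (n + 1) : ℝ) - s n) * c n := by
        have h1 := hγ.integral_inner_velocity ω (p n) hle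
        have h2 : IntervalIntegrable (fun r => -inner ℝ (p n) (velocity (γ ω) r)) volume
            (s n) (s (n + 1)) := (hγ.intervalIntegrable_inner_velocity ω (p n) hle).neg
        simp only [hq, inner_neg_right]
        rw [intervalIntegral.integral_sub h2 intervalIntegrable_const,
          intervalIntegral.integral_neg, h1, intervalIntegral.integral_const, smul_eq_mul,
          ← inner_neg_right, neg_sub]
      set g' : ℝ → ℝ := fun r => if r ≤ s n then g r else q r with hg'
      have e1 : ∀ r ∈ uIoc (0 : ℝ) (s n), g r = g' r := by
        intro r hr
        rw [uIoc_of_le (NNReal.coe_nonneg _)] at hr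
        simp only [hg', if_pos hr.2]
      have e2 : ∀ r ∈ uIoc (s n : ℝ) (s (n + 1)), q r = g' r := by
        intro r hr
        rw [uIoc_of_le hle'] at hr
        simp only [hg', if_neg (not_le.2 hr.1)]
      have i1 : IntervalIntegrable g' volume 0 (s n) := hg.congr e1
      have i2 : IntervalIntegrable g' volume (s n) (s (n + 1)) := hqi.congr e2
      refine ⟨g', i1.trans i2, ?_, ?_⟩
      · rw [← intervalIntegral.integral_add_adjacent_intervals i1 i2, Finset.sum_range_succ, ← hgi,
          ← hqint]
        congr 1
        · exact (intervalIntegral.integral_congr_ae (ae_of_all _ e1)).symm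
        · exact (intervalIntegral.integral_congr_ae (ae_of_all _ e2)).symm
      · intro r hr
        by_cases hrn : r ≤ s n
        · simp only [hg', if_pos hrn]
          exact hgle r ⟨hr.1, hrn⟩
        · simp only [hg', if_neg hrn]
          exact h n n.lt_succ_self r ⟨not_le.1 hrn, hr.2⟩
  rw [← hgi, intervalIntegral.integral_of_le (NNReal.coe_nonneg _)]
  refine integral_le_extIntegral ?_ ?_
  · exact (intervalIntegrable_iff_integrableOn_Ioc_of_le (NNReal.coe_nonneg _)).1 hg
  · refine (ae_restrict_iff' measurableSet_Ioc).2 (ae_of_all _ fun r hr => ?_)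
    exact EReal.coe_le_coe_iff.2 (hgle r hr)

theorem IsAdmissible.measurable_apply {m N : ℕ} {γ : PathSpace m → C(ℝ≥0, E N)}
    (hγ : IsAdmissible γ) (s : ℝ≥0) : Measurable fun ω => γ ω s := by
  let _ : MeasurableSpace C(ℝ≥0, E N) := borel _
  have : BorelSpace C(ℝ≥0, E N) := ⟨rfl⟩
  have h : Measurable fun c : C(ℝ≥0, E N) => c s := (continuous_eval_const s).measurable
  exact h.comp hγ.meas

theorem IsAdmissible.apply_stopAt {m N : ℕ} {γ : PathSpace m → C(ℝ≥0, E N)}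
    (hγ : IsAdmissible γ) (s : ℝ≥0) (ω : PathSpace m) : γ (stopAt s ω) s = γ ω s :=
  hγ.nonant s _ _ (fun _ hr => stopAt_apply_of_le ω hr) s le_rfl

theorem exists_forall_abs_sub_le_of_isHamiltonian {m N : ℕ} {H : Fin m → E N → E N → ℝ}
    (hH : ∀ i, IsHamiltonian (H i)) (R : ℝ) {η : ℝ} (hη : 0 < η) :
    ∃ δ : ℝ, 0 < δ ∧ ∀ j x y, dist x y < δ → ∀ p : E N, ‖p‖ ≤ R → |H j x p - H j y p| ≤ η := by
  have h1 : ∀ j, ∃ δ : ℝ, 0 < δ ∧ ∀ x y, dist x y < δ → ∀ p : E N, ‖p‖ ≤ R →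
      |H j x p - H j y p| ≤ η := by
    intro j
    obtain ⟨δ, hδ, h⟩ := Metric.uniformContinuousOn_iff.1 ((hH j).uc (|R| + 1) (by positivity)) η hη
    refine ⟨δ, hδ, fun x y hxy p hp => ?_⟩
    have hp' : p ∈ Metric.ball (0 : E N) (|R| + 1) := by
      rw [mem_ball_zero_iff]; linarith [le_abs_self R]
    exact (h (x, p) ⟨mem_univ _, hp'⟩ (y, p) ⟨mem_univ _, hp'⟩
      (by rwa [dist_prod_same_right])).le
  choose δ hδ h using h1
  have h2 : ∀ᶠ d in 𝓝[>] (0 : ℝ), ∀ j, d < δ j := eventually_all.2 fun j =>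
    (eventually_lt_nhds (hδ j)).filter_mono nhdsWithin_le_nhds
  obtain ⟨d, hd, hd0⟩ := (h2.and self_mem_nhdsWithin).exists
  exact ⟨d, hd0, fun j x y hxy => h j x y (hxy.trans (hd j))⟩

theorem abs_mulVec_sub_mulVec_le {m : ℕ} (B : Matrix (Fin m) (Fin m) ℝ) (v w : Fin m → ℝ)
    (j : Fin m) : |B.mulVec v j - B.mulVec w j| ≤ (∑ l, ∑ k, |B l k|) * ‖v - w‖ := by
  simp only [Matrix.mulVec, dotProduct, ← Finset.sum_sub_distrib, ← mul_sub]
  calc |∑ k, B j k * (v k - w k)| ≤ ∑ k, |B j k| * ‖v - w‖ := by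
        refine (Finset.abs_sum_le_sum_abs _ _).trans (Finset.sum_le_sum fun k _ => ?_)
        rw [abs_mul]
        exact mul_le_mul_of_nonneg_left (norm_le_pi_norm (v - w) k) (abs_nonneg _)
    _ = (∑ k, |B j k|) * ‖v - w‖ := by rw [Finset.sum_mul]
    _ ≤ _ := by
        refine mul_le_mul_of_nonneg_right ?_ (norm_nonneg _)
        exact Finset.single_le_sum (f := fun l => ∑ k, |B l k|)
          (fun l _ => Finset.sum_nonneg fun k _ => abs_nonneg _) (Finset.mem_univ j)

/-- The increment of a subsolution along a path and a curve over a short time interval `[a, a + h]`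
is bounded from below by a piece of the action, up to a martingale increment, and up to an error
that is small with respect to `h` unless the path jumps. -/
theorem IsSubsolution.exists_step_le {N m : ℕ} {H : Fin m → E N → E N → ℝ}
    (hH : ∀ i, IsHamiltonian (H i))
    {B : Matrix (Fin m) (Fin m) ℝ} {u : ℝ × E N → Fin m → ℝ} (hsub : IsSubsolution H B u)
    (hu : ContinuousOn u (Ici (0 : ℝ) ×ˢ univ)) {K : ℝ≥0} {t a h : ℝ≥0} (hh : 0 < h)
    (hat : a + h ≤ t) {x : E N} {R ε η M c₀ : ℝ}
    (hLip : LipschitzOnWith K u (Icc (0 : ℝ) t ×ˢ Metric.closedBall x (R + 1)))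
    (hM : ∀ z ∈ Icc (0 : ℝ) t ×ˢ Metric.closedBall x (R + 1), ‖u z‖ ≤ M)
    (hη : 0 < η) (hε : 0 < ε) (hε1 : 2 * ε ≤ 1) (hhε : h ≤ ε)
    (hmod : ∀ j y z, dist y z ≤ 2 * ε → ∀ p : E N, ‖p‖ ≤ 2 * K → |H j y p - H j z p| ≤ η)
    (hc₀ : ∀ j y, H j y 0 ≤ c₀) (hc₀' : 0 ≤ c₀) (ω : PathSpace m) (c : C(ℝ≥0, E N))
    (hR : ∀ s ≤ t, c s ∈ Metric.closedBall x R)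
    (hosc : ∀ s, a ≤ s → s ≤ a + h → ‖c s - c a‖ ≤ ε) :
    ∃ (p : E N) (d : ℝ),
      (∀ r ∈ Ioc (a : ℝ) ((a + h : ℝ≥0) : ℝ), inner ℝ p (-velocity c r) - d ≤
        lagrangian (H (ω r.toNNReal)) (c r.toNNReal) (-velocity c r)) ∧
      u ((t : ℝ) - a, c a) (ω a) + (u ((t : ℝ) - (a + h : ℝ≥0), c a) (ω (a + h)) -
          u ((t : ℝ) - (a + h : ℝ≥0), c a) (ω a) +
          (((a + h : ℝ≥0) : ℝ) - a) * B.mulVec (u ((t : ℝ) - (a + h : ℝ≥0), c a)) (ω a)) -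
          (((a + h : ℝ≥0) : ℝ) - a) * (3 * η + (∑ l, ∑ k, |B l k|) * (K * (2 * ε))) -
          (jump m a h).indicator (fun _ => (2 * K + (∑ l, ∑ k, |B l k|) * M + c₀) * ε) ω ≤
        u ((t : ℝ) - (a + h : ℝ≥0), c (a + h)) (ω (a + h)) +
          (inner ℝ p (c a - c (a + h)) - (((a + h : ℝ≥0) : ℝ) - a) * d) := by
  have hhpos : (0 : ℝ) < h := hh
  have hat' : (a : ℝ) + h ≤ t := by exact_mod_cast hat
  have ha0 : (0 : ℝ) ≤ a := a.2
  have hsub' : ((a + h : ℝ≥0) : ℝ) - a = h := by push_cast; ring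
  have hah : ((a + h : ℝ≥0) : ℝ) = a + h := by push_cast; ring
  rw [hsub', hah]
  set b : ℝ := ∑ l, ∑ k, |B l k| with hb
  have hb0 : 0 ≤ b := Finset.sum_nonneg fun l _ => Finset.sum_nonneg fun k _ => abs_nonneg _
  set Q := Icc (0 : ℝ) t ×ˢ Metric.closedBall x (R + 1) with hQ
  have hca := hR a ((le_add_of_nonneg_right zero_le).trans hat)
  have hcb := hR (a + h) hat
  have hRR : Metric.closedBall x R ⊆ Metric.closedBall x (R + 1) :=
    Metric.closedBall_subset_closedBall (by linarith)
  have hball : Metric.closedBall (c a) (2 * ε) ⊆ Metric.closedBall x (R + 1) :=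
    Metric.closedBall_subset_closedBall' (by rw [Metric.mem_closedBall] at hca; linarith)
  have hcoord : ∀ z ∈ Q, ∀ z' ∈ Q, ∀ j, u z j - u z' j ≤ K * dist z z' := by
    intro z hz z' hz' j
    have h1 := hLip.dist_le_mul z hz z' hz'
    rw [dist_eq_norm] at h1
    exact ((le_abs_self _).trans (norm_le_pi_norm (u z - u z') j)).trans h1
  have m1 : ((t : ℝ) - a, c a) ∈ Q := ⟨⟨by linarith, by linarith⟩, hRR hca⟩
  have m2 : ((t : ℝ) - (a + h), c a) ∈ Q := ⟨⟨by linarith, by linarith⟩, hRR hca⟩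
  have m3 : ((t : ℝ) - (a + h), c (a + h)) ∈ Q := ⟨⟨by linarith, by linarith⟩, hRR hcb⟩
  have hosc' := hosc (a + h) (le_add_of_nonneg_right zero_le) le_rfl
  by_cases hω : ω ∈ jump m a h
  -- If the path jumps, the zero momentum gives L ≥ -c₀. Lipschitz bounds in time and space cost
  -- 2Kε; the coupling and the action cost the other two terms of the indicator's constant.
  · refine ⟨0, c₀, fun r _ => ?_, ?_⟩
    · have h1 := (hH (ω r.toNNReal)).inner_sub_le_lagrangian (c r.toNNReal) 0 (-velocity c r)
      have h2 := hc₀ (ω r.toNNReal) (c r.toNNReal)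
      rw [inner_zero_left] at h1 ⊢
      linarith
    · rw [indicator_of_mem hω, inner_zero_left]
      have h1 := hcoord _ m1 _ m2 (ω a)
      have h2 := hcoord _ m2 _ m3 (ω (a + h))
      rw [dist_prod_same_right, Real.dist_eq,
        show (t : ℝ) - a - (t - (a + h)) = h by ring, abs_of_pos hhpos] at h1
      rw [dist_prod_same_left, dist_eq_norm, norm_sub_rev] at h2
      have h3 := abs_mulVec_sub_mulVec_le B (u ((t : ℝ) - (a + h), c a)) 0 (ω a)
      rw [Matrix.mulVec_zero, Pi.zero_apply, sub_zero, sub_zero] at h3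
      have h4 : (h : ℝ) * B.mulVec (u ((t : ℝ) - (a + h), c a)) (ω a) ≤ b * M * ε := by
        have h5 : B.mulVec (u ((t : ℝ) - (a + h), c a)) (ω a) ≤ b * M :=
          (le_abs_self _).trans (h3.trans (mul_le_mul_of_nonneg_left (hM _ m2) hb0))
        have h6 : 0 ≤ b * M := mul_nonneg hb0 ((norm_nonneg _).trans (hM _ m2))
        calc _ ≤ (h : ℝ) * (b * M) := mul_le_mul_of_nonneg_left h5 hhpos.le
          _ ≤ ε * (b * M) := mul_le_mul_of_nonneg_right hhε h6
          _ = _ := by ring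
      have h5 : (K : ℝ) * h ≤ K * ε := mul_le_mul_of_nonneg_left hhε K.2
      have h6 : (K : ℝ) * ‖c (a + h) - c a‖ ≤ K * ε := mul_le_mul_of_nonneg_left hosc' K.2
      have h7 : (h : ℝ) * c₀ ≤ ε * c₀ := mul_le_mul_of_nonneg_right hhε hc₀'
      have h8 : 0 ≤ (h : ℝ) * (3 * η + b * (K * (2 * ε))) := by positivity
      linarith
  · have hconst : ∀ r, a ≤ r → r ≤ a + h → ω r = ω a := fun r h1 h2 =>
      apply_eq_of_notMem_jump hh hω h1 h2
    have hQsub : Icc ((t : ℝ) - (a + h)) (t - a) ×ˢ Metric.closedBall (c a) (2 * ε) ⊆ Q :=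
      prod_mono (Icc_subset_Icc (by linarith) (by linarith)) hball
    obtain ⟨p, hpK, hp⟩ := hsub.exists_increment_le hu (τ := (t : ℝ) - (a + h)) (σ := t - a)
      (ξ := c a) (ζ := c (a + h)) (κ := b * (K * (2 * ε))) (by linarith) (by linarith) hε hη hosc'
      (hLip.mono hQsub) (ω a)
      (fun y hy p hp => hmod _ _ _ hy p hp) (fun z hz => by
        refine (abs_mulVec_sub_mulVec_le B _ _ _).trans (mul_le_mul_of_nonneg_left ?_ hb0)
        rw [← dist_eq_norm]
        refine (hLip.dist_le_mul z (hQsub hz) _ m2).trans (mul_le_mul_of_nonneg_left ?_ K.2)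
        rw [Prod.dist_eq]
        refine max_le ?_ hz.2
        rw [Real.dist_eq, abs_of_nonneg (sub_nonneg.2 hz.1.1)]
        linarith [hz.1.2])
    -- The state is constant on the step, so one Hamiltonian is involved; the extra η pays for
    -- moving its base point from c a to c r, which makes 3η in all.
    refine ⟨p, H (ω a) (c a) p + η, fun r hr => ?_, ?_⟩
    · have hr0 : 0 ≤ r := ha0.trans hr.1.le
      have hra : a ≤ r.toNNReal := by
        rw [← NNReal.coe_le_coe, Real.coe_toNNReal _ hr0]; exact hr.1.le
      have hrb : r.toNNReal ≤ a + h := by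
        rw [← NNReal.coe_le_coe, Real.coe_toNNReal _ hr0]; exact hr.2
      rw [hconst _ hra hrb]
      have h1 := (hH (ω a)).inner_sub_le_lagrangian (c r.toNNReal) p (-velocity c r)
      have h2 := hmod (ω a) (c r.toNNReal) (c a)
        (by rw [dist_eq_norm]; linarith [hosc _ hra hrb]) p hpK
      linarith [(abs_le.1 h2).2]
    · rw [indicator_of_notMem hω, hconst _ (le_add_of_nonneg_right zero_le) le_rfl]
      rw [show (t : ℝ) - a - (t - (a + h)) = h by ring] at hp
      linarith

/-! ### Summation over the steps and expectation -/

theorem PathSpace.integrable_comp_apply {m : ℕ} (s : ℝ≥0) {Y : Fin m → PathSpace m → ℝ}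
    {μ : Measure (PathSpace m)} (hY : ∀ j, Integrable (Y j) μ) :
    Integrable (fun ω : PathSpace m => Y (ω s) ω) μ := by
  have h : (fun ω : PathSpace m => Y (ω s) ω) =
      fun ω => ∑ j, {ω : PathSpace m | ω s = j}.indicator (Y j) ω := by
    ext ω
    simp [indicator_apply]
  rw [h]
  exact integrable_finsetSum _ fun j _ => (hY j).indicator (measurableSet_eq s j)

theorem exists_nat_div_lt (t : ℝ≥0) {δ : ℝ} (hδ : 0 < δ) : ∃ n : ℕ, 0 < n ∧ (t : ℝ) / n < δ := by
  obtain ⟨n, hn⟩ := exists_nat_gt ((t : ℝ) / δ)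
  have hn0 : (0 : ℝ) < n := (div_nonneg t.2 hδ.le).trans_lt hn
  refine ⟨n, by exact_mod_cast hn0, ?_⟩
  rw [div_lt_iff₀ hδ] at hn
  rw [div_lt_iff₀ hn0]
  linarith

theorem coe_le_of_forall_pos_sub_mul_le {a S : ℝ} {x : EReal}
    (h : ∀ η : ℝ, 0 < η → ((a - S * η : ℝ) : EReal) ≤ x) : (a : EReal) ≤ x := by
  have h1 : Tendsto (fun η : ℝ => ((a - S * η : ℝ) : EReal)) (𝓝[>] 0) (𝓝 (a : EReal)) := by
    have h2 : Tendsto (fun η : ℝ => a - S * η) (𝓝[>] 0) (𝓝 (a - S * 0)) :=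
      (((continuous_const.sub (continuous_const.mul continuous_id)).tendsto 0)).mono_left
        nhdsWithin_le_nhds
    rw [mul_zero, sub_zero] at h2
    exact (continuous_coe_real_ereal.tendsto a).comp h2
  refine le_of_tendsto h1 ?_
  filter_upwards [self_mem_nhdsWithin] with η hη using h η hη

theorem IsSubsolution.le_extIntegral {m N : ℕ}
    {H : Fin m → E N → E N → ℝ} (hH : ∀ i, IsHamiltonian (H i))
    {B : Matrix (Fin m) (Fin m) ℝ} (hB : IsCoupling B)
    {P : Measure (PathSpace m)} [IsProbabilityMeasure P]
    (hP : IsMarkovChain B P) (hpos : ∀ i, P (startsAt i) ≠ 0)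
    {u : ℝ × E N → Fin m → ℝ} (hLip : LocallyLipschitzOn (Ici (0 : ℝ) ×ˢ univ) u)
    (hsub : IsSubsolution H B u) {t : ℝ≥0} (ht : 0 < t) {x : E N} (i : Fin m)
    {γ : PathSpace m → C(ℝ≥0, E N)} (hγ : IsAdmissible γ) (hγ0 : ∀ ω, γ ω 0 = x) :
    ((u ((t : ℝ), x) i : ℝ) : EReal) ≤ extIntegral (condStart P i)
      (fun ω => ((u (0, γ ω t) (ω t) : ℝ) : EReal) + action H ω (γ ω) t) := by
  have hu : ContinuousOn u (Ici (0 : ℝ) ×ˢ univ) := hLip.continuousOn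
  obtain ⟨R, hR0, hR⟩ := hγ.exists_forall_norm_sub_le t
  have hR' : ∀ ω, ∀ s ≤ t, γ ω s ∈ Metric.closedBall x R := fun ω s hs => by
    rw [Metric.mem_closedBall, dist_eq_norm, ← hγ0 ω]; exact hR ω s hs
  -- All curves stay in the ball of radius R; the margin 1 leaves room for the balls of radius 2ε
  -- around their points. The constants K and M are thus independent of ω.
  have hQc : IsCompact (Icc (0 : ℝ) t ×ˢ Metric.closedBall x (R + 1)) :=
    isCompact_Icc.prod (isCompact_closedBall _ _)
  have hQ : Icc (0 : ℝ) t ×ˢ Metric.closedBall x (R + 1) ⊆ Ici (0 : ℝ) ×ˢ univ :=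
    prod_mono Icc_subset_Ici_self (subset_univ _)
  obtain ⟨K, hK⟩ := (hLip.mono hQ).exists_lipschitzOnWith_of_compact hQc
  obtain ⟨M, hM⟩ := hQc.exists_bound_of_continuousOn (hu.mono hQ)
  have hM0 : 0 ≤ M := (norm_nonneg _).trans (hM (0, x)
    ⟨⟨le_rfl, t.2⟩, Metric.mem_closedBall_self (by linarith)⟩)
  choose c hc using fun j => (hH j).exists_apply_zero_le
  obtain ⟨c₀, hc₀', hc₀⟩ : ∃ c₀ : ℝ, 0 ≤ c₀ ∧ ∀ j y, H j y 0 ≤ c₀ :=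
    ⟨∑ j, |c j|, Finset.sum_nonneg fun j _ => abs_nonneg _, fun j y =>
      ((hc j y).trans (le_abs_self _)).trans
        (Finset.single_le_sum (f := fun j => |c j|) (fun j _ => abs_nonneg _) (Finset.mem_univ j))⟩
  obtain ⟨C, δ₂, hC, hδ₂, hjump⟩ := hP.exists_measureReal_jump_le hB
  have := isProbabilityMeasure_condStart (hpos i)
  set μ := condStart P i with hμ
  set b : ℝ := ∑ l, ∑ k, |B l k| with hb
  have hb0 : 0 ≤ b := Finset.sum_nonneg fun l _ => Finset.sum_nonneg fun k _ => abs_nonneg _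
  set C₁ : ℝ := 2 * K + b * M + c₀ with hC₁
  have hC₁0 : 0 ≤ C₁ := by positivity
  -- Per unit of time and of η: M comes from the generator, 3 + 2bK from the one-step estimate, and
  -- C₁C from the jumps, using ε ≤ η.
  refine coe_le_of_forall_pos_sub_mul_le (S := t * (M + 3 + b * (K * 2) + C₁ * C)) fun η hη => ?_
  obtain ⟨δ₁, hδ₁, hgen⟩ := hP.exists_abs_integral_generator_le hB hη
  obtain ⟨δ₃, hδ₃, hmod⟩ := exists_forall_abs_sub_le_of_isHamiltonian hH (2 * K) hη
  obtain ⟨ε, hε, hεη, hε1, hε3⟩ : ∃ ε : ℝ, 0 < ε ∧ ε ≤ η ∧ 2 * ε ≤ 1 ∧ 2 * ε < δ₃ := by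
    refine ⟨min η (min (1 / 2) (δ₃ / 3)), by positivity, min_le_left _ _, ?_, ?_⟩
    · linarith [(min_le_right η (min (1 / 2) (δ₃ / 3))).trans (min_le_left _ _)]
    · linarith [(min_le_right η (min (1 / 2) (δ₃ / 3))).trans (min_le_right _ _)]
  obtain ⟨δ₄, hδ₄, hosc⟩ := hγ.exists_norm_sub_lt t hε
  obtain ⟨n, hn, hlt⟩ := exists_nat_div_lt t (δ := min (min δ₁ δ₂) (min δ₄ ε)) (by positivity)
  set h : ℝ≥0 := t / n with hh
  have hn' : (0 : ℝ≥0) < n := by exact_mod_cast hn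
  have hhpos : 0 < h := by positivity
  have hnh : (n : ℝ) * h = t := by
    rw [hh]; push_cast; rw [mul_div_cancel₀ _ (by positivity)]
  have hltδ : (h : ℝ) < min (min δ₁ δ₂) (min δ₄ ε) := by rw [hh]; push_cast; exact hlt
  obtain ⟨⟨hh1, hh2⟩, hh4, hhε⟩ : ((h : ℝ) < δ₁ ∧ (h : ℝ) < δ₂) ∧ (h : ℝ) < δ₄ ∧ (h : ℝ) < ε := by
    simpa only [lt_min_iff] using hltδ
  set s : ℕ → ℝ≥0 := fun k => k * h with hs
  have hsucc : ∀ k, s (k + 1) = s k + h := fun k => by simp only [hs]; push_cast; ring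
  have hsmono : Monotone s := monotone_nat_of_le_succ fun k => by
    rw [hsucc]; exact le_add_of_nonneg_right zero_le
  have hs0 : s 0 = 0 := by simp [hs]
  have hsn : s n = t := by rw [← NNReal.coe_inj, ← hnh]; simp [hs]
  have hst : ∀ k < n, s k + h ≤ t := fun k hk => by
    rw [← hsucc, ← hsn]; exact hsmono hk
  have hdiff : ∀ k, ((s k + h : ℝ≥0) : ℝ) - s k = h := fun k => by push_cast; ring
  set e : ℝ := 3 * η + b * (K * (2 * ε)) with he
  -- The position is taken at the start of the step, so by nonanticipation `Y k j` depends only on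
  -- the path up to s k. This makes W k an approximate martingale increment.
  set Y : ℕ → Fin m → PathSpace m → ℝ := fun k j ω =>
    u ((t : ℝ) - (s k + h : ℝ≥0), γ ω (s k)) j with hY
  set W : ℕ → PathSpace m → ℝ := fun k ω => Y k (ω (s k + h)) ω - Y k (ω (s k)) ω +
    (((s k + h : ℝ≥0) : ℝ) - s k) * ∑ j, B (ω (s k)) j * Y k j ω with hW
  set J : ℕ → PathSpace m → ℝ := fun k => (jump m (s k) h).indicator fun _ => C₁ * ε with hJ
  have hYm : ∀ k < n, ∀ j, Measurable (Y k j) := by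
    intro k hk j
    have h1 : Continuous fun y => u ((t : ℝ) - (s k + h : ℝ≥0), y) j :=
      (continuous_apply j).comp (hu.comp_continuous (by fun_prop) fun y =>
        ⟨sub_nonneg.2 (NNReal.coe_le_coe.2 (hst k hk)), mem_univ _⟩)
    exact h1.measurable.comp (hγ.measurable_apply (s k))
  have hYM : ∀ k < n, ∀ j ω, |Y k j ω| ≤ M := by
    intro k hk j ω
    have h1 := NNReal.coe_le_coe.2 (hst k hk)
    have h2 := (s k + h).2
    refine (norm_le_pi_norm (u ((t : ℝ) - (s k + h : ℝ≥0), γ ω (s k))) j).trans (hM _ ⟨⟨?_, ?_⟩, ?_⟩)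
    · exact sub_nonneg.2 h1
    · exact sub_le_self _ h2
    · exact Metric.closedBall_subset_closedBall (by linarith)
        (hR' ω _ ((le_add_of_nonneg_right zero_le).trans (hst k hk)))
  have hYi : ∀ k < n, ∀ j, Integrable (Y k j) μ := fun k hk j =>
    Integrable.of_bound (hYm k hk j).aestronglyMeasurable M (ae_of_all _ (hYM k hk j))
  have hWi : ∀ k < n, Integrable (W k) μ := fun k hk =>
    ((integrable_comp_apply (s k + h) (hYi k hk)).sub (integrable_comp_apply (s k) (hYi k hk))).add
      ((integrable_comp_apply (Y := fun l ω => ∑ j, B l j * Y k j ω) (s k)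
        fun l => integrable_finsetSum _ fun j _ => (hYi k hk j).const_mul _).const_mul _)
  have hJi : ∀ k, Integrable (J k) μ := fun k =>
    (integrable_const _).indicator (measurableSet_jump _ _ _)
  have hterm : ∀ k ∈ Finset.range n, Integrable (fun ω => W k ω - h * e - J k ω) μ := fun k hk =>
    ((hWi k (Finset.mem_range.1 hk)).sub (integrable_const _)).sub (hJi k)
  have hu0 : ∀ᵐ ω ∂μ, u ((t : ℝ), x) (ω 0) = u ((t : ℝ), x) i := by
    filter_upwards [ProbabilityTheory.ae_cond_mem (μ := P) (measurableSet_eq (m := m) 0 i)] with ω hω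
    rw [show ω 0 = i from hω]
  set G : PathSpace m → ℝ := fun ω => u ((t : ℝ), x) i +
    ∑ k ∈ Finset.range n, (W k ω - h * e - J k ω) with hG
  have hGi : Integrable G μ := (integrable_const _).add (integrable_finsetSum _ hterm)
  have hGint : u ((t : ℝ), x) i - t * (M + 3 + b * (K * 2) + C₁ * C) * η ≤ ∫ ω, G ω ∂μ := by
    rw [hG, integral_add (integrable_const _) (integrable_finsetSum _ hterm),
      integral_finsetSum _ hterm, integral_const, probReal_univ, one_smul, sub_eq_add_neg]
    refine add_le_add_right ?_ _
    have hk : ∀ k ∈ Finset.range n, -(h * ((M + 3 + b * (K * 2) + C₁ * C) * η)) ≤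
        ∫ ω, (W k ω - h * e - J k ω) ∂μ := by
      intro k hk
      have hk' := Finset.mem_range.1 hk
      have i1 : Integrable (fun ω => W k ω - h * e) μ := (hWi k hk').sub (integrable_const _)
      rw [integral_sub i1 (hJi k), integral_sub (hWi k hk') (integrable_const _), integral_const,
        probReal_univ, one_smul]
      have h1 := hgen (s k) (s k + h) (lt_add_of_pos_right _ hhpos) (by rw [hdiff]; exact hh1)
        (Y k) M (hYm k hk') (fun j ω => by simp only [hY, hγ.apply_stopAt]) (hYM k hk') i (hpos i)
      have h2 := (abs_le.1 h1).1
      rw [hdiff] at h2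
      have h3 : ∫ ω, J k ω ∂μ ≤ C * h * (C₁ * ε) := by
        rw [hJ, integral_indicator_const _ (measurableSet_jump _ _ _), smul_eq_mul]
        exact mul_le_mul_of_nonneg_right (hjump (s k) h hhpos hh2 i (hpos i)) (by positivity)
      have h4 : C * h * (C₁ * ε) ≤ C * h * (C₁ * η) := by gcongr
      have h5 : h * e ≤ h * (3 * η + b * (K * (2 * η))) := by rw [he]; gcongr
      have h6 : ∫ ω, W k ω ∂μ = ∫ ω, (Y k (ω (s k + h)) ω - Y k (ω (s k)) ω +
        (h : ℝ) * ∑ j, B (ω (s k)) j * Y k j ω) ∂μ := by simp only [hW, hdiff]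
      rw [h6]
      rw [hμ]
      linarith
    refine le_trans (le_of_eq ?_) (Finset.sum_le_sum hk)
    rw [Finset.sum_const, Finset.card_range, nsmul_eq_mul, ← hnh]
    ring
  refine (EReal.coe_le_coe_iff.2 hGint).trans (integral_le_extIntegral hGi ?_)
  filter_upwards [hu0] with ω hω
  have hstep : ∀ k : ℕ, ∃ (p : E N) (d : ℝ), k < n →
      (∀ r ∈ Ioc (s k : ℝ) (s (k + 1)), inner ℝ p (-velocity (γ ω) r) - d ≤
        lagrangian (H (ω r.toNNReal)) (γ ω r.toNNReal) (-velocity (γ ω) r)) ∧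
      W k ω - h * e - J k ω ≤
        (u ((t : ℝ) - s (k + 1), γ ω (s (k + 1))) (ω (s (k + 1))) -
          u ((t : ℝ) - s k, γ ω (s k)) (ω (s k))) +
        (inner ℝ p (γ ω (s k) - γ ω (s (k + 1))) - ((s (k + 1) : ℝ) - s k) * d) := by
    intro k
    by_cases hk : k < n
    · obtain ⟨p, d, h1, h2⟩ := hsub.exists_step_le hH hu hhpos (hst k hk) hK hM hη hε hε1 hhε.le
        (fun j y z hyz => hmod j y z (hyz.trans_lt hε3)) hc₀ hc₀' ω (γ ω) (hR' ω)
        (fun r hr1 hr2 => by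
          refine (hosc (s k) r hr1 (hr2.trans (hst k hk)) ?_ ω).le
          have h3 : (r : ℝ) ≤ s k + h := by exact_mod_cast hr2
          linarith)
      refine ⟨p, d, fun _ => ⟨by rw [hsucc]; exact h1, ?_⟩⟩
      rw [hsucc]
      simp only [Matrix.mulVec, dotProduct] at h2
      have h3 := hdiff k
      simp only [hW, hJ, hY]
      rw [← hb, ← he] at h2
      rw [h3] at h2 ⊢
      linarith
    · exact ⟨0, 0, fun hk' => absurd hk' hk⟩
  -- The choice is made for a fixed ω; no measurability in ω is needed, since p and d do not occur
  -- in the integrated minorant G.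
  choose p d hpd using hstep
  have hact := hγ.sum_le_action (H := H) ω hsmono hs0 p d n fun k hk => (hpd k hk).1
  rw [hsn] at hact
  refine le_trans ?_ (add_le_add_right hact _)
  rw [← EReal.coe_add, EReal.coe_le_coe_iff]
  -- The increments of u telescope between (t, x), with state i, and (0, γ(t)), with state ω(t).
  have hsum := Finset.sum_le_sum fun k (hk : k ∈ Finset.range n) => (hpd k (Finset.mem_range.1 hk)).2
  rw [Finset.sum_add_distrib, Finset.sum_range_sub
    (fun k => u ((t : ℝ) - s k, γ ω (s k)) (ω (s k))), hsn, hs0, sub_self, NNReal.coe_zero, sub_zero,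
    hγ0, hω] at hsum
  simp only [hG]
  linarith

end RandomLaxOleinik

open RandomLaxOleinik
theorem mainTheorem6 {m N : ℕ}
    (H : Fin m → E N → E N → ℝ) (hH : ∀ i, IsHamiltonian (H i))
    (B : Matrix (Fin m) (Fin m) ℝ) (hB : IsCoupling B)
    (P : Measure (PathSpace m)) [IsProbabilityMeasure P]
    (hP : IsMarkovChain B P) (hpos : ∀ i, P (startsAt i) ≠ 0)
    (u : ℝ × E N → Fin m → ℝ)
    (hLip : LocallyLipschitzOn (Ici (0 : ℝ) ×ˢ univ) u)
    (hsub : IsSubsolution H B u)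
    (hbdd : ∃ C : ℝ, ∀ x i, |u (0, x) i| ≤ C) :
    ∀ (t : ℝ≥0) (x : E N) (i : Fin m),
      ((u ((t : ℝ), x) i : ℝ) : EReal) ≤ laxOleinik H P t (fun y => u (0, y)) x i := by
  intro t x i
  refine le_iInf fun γ => le_iInf fun hγ => le_iInf fun hγ0 => ?_
  rcases eq_zero_or_pos t with rfl | ht
  -- At t = 0 there is no positive step length, but the action vanishes and the integrand is almost
  -- surely the constant u_i(0, x).
  · have := isProbabilityMeasure_condStart (hpos i)
    have h1 := integral_le_extIntegral (μ := condStart P i)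
      (f := fun ω => ((u (0, γ ω 0) (ω 0) : ℝ) : EReal) + action H ω (γ ω) 0)
      (integrable_const (u (0, x) i)) ?_
    · simpa using h1
    · filter_upwards [ProbabilityTheory.ae_cond_mem (μ := P)
        (PathSpace.measurableSet_eq (m := m) 0 i)] with ω hω
      rw [hγ0, show ω 0 = i from hω]
      simp [action, extIntegral]
  · exact hsub.le_extIntegral hH hB hP hpos hLip ht i hγ hγ0
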